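/- **Proposition ($\Sigma$-Killing vector fields are Killing).** Let $M$ be a smooth 4-manifold with a triple of smooth 2-forms $\Sigma^1,\Sigma^2,\Sigma^3$ such that $\Sigma^i\wedge\Sigma^j=\delta^{ij}\mu$ for a 4-form $\mu$ that vanishes nowhere (an $SU(2)$ structure). Let $g$ be the Riemannian metric defined by the triple, that is, $$g(u,v)\,\nu_g=\tfrac16\,\epsilon^{ijk}\,\iota_u\Sigma^i\wedge\iota_v\Sigma^j\wedge\Sigma^k$$ at each point, where $\nu_g$ is a volume form of $g$ (its sign is the one for which $g$ is positive definite). Let $X$ be a smooth vector field on $M$ and $\tilde\theta^1,\tilde\theta^2,\tilde\theta^3$ functions on $M$ such that $$\mathcal L_X\Sigma^i=\epsilon^{ijk}\,\tilde\theta^j\,\Sigma^k .$$ 1. $X$ is a Killing vector field of $g$: $\mathcal L_Xg=0$. 2. Let $A^i$ be the $\Sigma$-compatible connection, i.e. the triple of 1-forms with $d\Sigma^i+\epsilon^{ijk}A^j\wedge\Sigma^k=0$, and put $\theta^i=\tilde\theta^i+\iota_XA^i$. Then $d^A\iota_X\Sigma^i:=d(\iota_X\Sigma^i)+\epsilon^{ijk}A^j\wedge\iota_X\Sigma^k=\epsilon^{ijk}\,\theta^j\,\Sigma^k$.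 Moreover, wherever the triple satisfies the quaternion algebra $\Sigma^i{}_\mu{}^\alpha\,\Sigma^j{}_\alpha{}^\nu=-\delta^{ij}\delta_\mu^\nu+\epsilon^{ijk}\,\Sigma^k{}_\mu{}^\nu$ (indices raised with $g$; at each point this holds for one of the triples $\Sigma^i$, $-\Sigma^i$), $$\theta^i=-\tfrac14\,\Sigma^{i\,\mu\nu}\,(dX^\flat)_{\mu\nu},\qquad (dX^\flat)_{\mu\nu}=\nabla_\mu X_\nu-\nabla_\nu X_\mu,$$ where $X^\flat=g(X,\cdot)$. That is, the self-dual projection of $dX^\flat$ is $$\tfrac12\left(dX^\flat+\star dX^\flat\right)=-\theta^i\,\Sigma^i,$$ where $\star$ is the Hodge star of $g$ for the orientation in which the $\Sigma^i$ are self-dual. -/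

import Mathlib

open scoped Manifold ContDiff

noncomputable section

namespace SigmaKilling

/-- The model space `ℝ⁴`. -/
abbrev E4 : Type := EuclideanSpace ℝ (Fin 4)

/-! ### Pointwise (multi)linear algebra -/

/-- The Levi-Civita symbol `ε^{ijk}` on three indices, with `ε^{012} = 1`. -/
def eps (i j k : Fin 3) : ℝ :=
  (((j : ℕ) : ℝ) - ((i : ℕ) : ℝ)) * (((k : ℕ) : ℝ) - ((i : ℕ) : ℝ)) *
    (((k : ℕ) : ℝ) - ((j : ℕ) : ℝ)) / 2

section Pointwise

variable {V : Type*}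

/-- Wedge product of two 1-forms. -/
def wedge11 (α β : V → ℝ) (u v : V) : ℝ := α u * β v - α v * β u

/-- Wedge product of a 1-form and a 2-form. -/
def wedge12 (α : V → ℝ) (τ : V → V → ℝ) (u v w : V) : ℝ :=
  α u * τ v w - α v * τ u w + α w * τ u v

/-- Wedge product of two 2-forms (sum over the six (2,2)-shuffles). -/
def wedge22 (τ η : V → V → ℝ) (a b c d : V) : ℝ :=
  τ a b * η c d - τ a c * η b d + τ a d * η b c
    + τ b c * η a d - τ b d * η a c + τ c d * η a b

variable [AddCommGroup V] [Module ℝ V] [TopologicalSpace V]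

/-- A 2-form as a function of two vectors. -/
def ev2 (τ : V [⋀^Fin 2]→L[ℝ] ℝ) (u v : V) : ℝ := τ ![u, v]

/-- Interior product `ι_x τ` of a 2-form, i.e. the covector `v ↦ τ (x, v)`. -/
def interior2 (x : V) (τ : V [⋀^Fin 2]→L[ℝ] ℝ) : V →L[ℝ] ℝ :=
  τ.toContinuousMultilinearMap.toContinuousLinearMap ![x, 0] 1

theorem interior2_apply (x v : V) (τ : V [⋀^Fin 2]→L[ℝ] ℝ) :
    interior2 x τ v = ev2 τ x v := by
  have h : Function.update ![x, (0 : V)] 1 v = ![x, v] := by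
    funext i
    fin_cases i <;> simp
  exact congrArg τ h

/-- `b` is an orthonormal frame of the 4-dimensional inner product `g`. -/
def IsOrthonormalFrame (g : V →L[ℝ] V →L[ℝ] ℝ) (b : Fin 4 → V) : Prop :=
  ∀ μ ν, g (b μ) (b ν) = if μ = ν then 1 else 0

/-- `vol` is one of the two volume forms `± ν_g` of the inner product `g`. -/
def IsVolumeForm (g : V →L[ℝ] V →L[ℝ] ℝ) (vol : V [⋀^Fin 4]→L[ℝ] ℝ) : Prop :=
  ∀ b, IsOrthonormalFrame g b → |vol b| = 1

/-- An `SU(2)` triple of 2-forms: `Σ^i ∧ Σ^j = δ^{ij} μ` for a non-zero 4-form `μ`. -/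
def IsSU2Triple (S : Fin 3 → V [⋀^Fin 2]→L[ℝ] ℝ) : Prop :=
  ∃ μ : V [⋀^Fin 4]→L[ℝ] ℝ, μ ≠ 0 ∧ ∀ i j a b c d,
    wedge22 (ev2 (S i)) (ev2 (S j)) a b c d = if i = j then μ ![a, b, c, d] else 0

/-- `g` is the inner product defined by the triple `Σ^i`:
`g(u,v) ν_g = (1/6) ε^{ijk} ι_u Σ^i ∧ ι_v Σ^j ∧ Σ^k`, where `ν_g` is a volume form of `g`. -/
def IsMetricOf (S : Fin 3 → V [⋀^Fin 2]→L[ℝ] ℝ) (g : V →L[ℝ] V →L[ℝ] ℝ) : Prop :=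
  ∃ vol : V [⋀^Fin 4]→L[ℝ] ℝ, IsVolumeForm g vol ∧ ∀ u v a b c d,
    g u v * vol ![a, b, c, d] =
      (1 / 6) * ∑ i, ∑ j, ∑ k, eps i j k *
        wedge22 (wedge11 (interior2 u (S i)) (interior2 v (S j))) (ev2 (S k)) a b c d

/-- The quaternion algebra `Σ^i_μ^α Σ^j_α^ν = -δ^{ij} δ_μ^ν + ε^{ijk} Σ^k_μ^ν`
(with the index `ν` lowered); `α` is summed over an orthonormal frame. -/
def IsQuaternionic (S : Fin 3 → V [⋀^Fin 2]→L[ℝ] ℝ) (g : V →L[ℝ] V →L[ℝ] ℝ) : Prop :=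
  ∀ b, IsOrthonormalFrame g b → ∀ i j u v,
    ∑ α, ev2 (S i) u (b α) * ev2 (S j) (b α) v =
      -(if i = j then g u v else 0) + ∑ k, eps i j k * ev2 (S k) u v

/-- The full contraction `τ^{μν} η_{μν}` of two 2-forms, computed in an orthonormal frame `b`. -/
def contract2 (b : Fin 4 → V) (τ η : V [⋀^Fin 2]→L[ℝ] ℝ) : ℝ :=
  ∑ μ, ∑ ν, ev2 τ (b μ) (b ν) * ev2 η (b μ) (b ν)

/-- The Hodge star of a 2-form, `(⋆τ)_{μν} = (1/2) vol_{μνρσ} τ^{ρσ}`, for the volume form `vol`,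
computed in an orthonormal frame `b`. -/
def hodge2 (vol : V [⋀^Fin 4]→L[ℝ] ℝ) (b : Fin 4 → V) (τ : V [⋀^Fin 2]→L[ℝ] ℝ) (u v : V) : ℝ :=
  (1 / 2) * ∑ ρ, ∑ σ, vol ![u, v, b ρ, b σ] * ev2 τ (b ρ) (b σ)

end Pointwise

/-! ### Forms and vector fields on a smooth 4-manifold -/

section Manifold

variable {M : Type*} [TopologicalSpace M] [ChartedSpace E4 M]

variable (M) in
/-- Differential `k`-forms on `M` (no smoothness imposed). -/
abbrev Form (k : ℕ) : Type _ := ∀ p : M, TangentSpace (𝓡 4) p [⋀^Fin k]→L[ℝ] ℝ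

variable (M) in
/-- 1-forms on `M`, as fields of covectors. -/
abbrev CovectorField : Type _ := ∀ p : M, TangentSpace (𝓡 4) p →L[ℝ] ℝ

variable (M) in
/-- Vector fields on `M` (no smoothness imposed). -/
abbrev VField : Type _ := ∀ p : M, TangentSpace (𝓡 4) p

/-- A field of covectors as a differential 1-form. -/
def CovectorField.toForm (α : CovectorField M) : Form M 1 := fun p =>
  ContinuousAlternatingMap.ofSubsingleton ℝ (TangentSpace (𝓡 4) p) ℝ (0 : Fin 1) (α p)

/-- The derivative at `y` of the inverse of the preferred chart at `p`. -/
def chartSymmDeriv (p : M) (y : E4) :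
    E4 →L[ℝ] TangentSpace (𝓡 4) ((extChartAt (𝓡 4) p).symm y) :=
  mfderiv 𝓘(ℝ, E4) (𝓡 4) (extChartAt (𝓡 4) p).symm y

/-- The derivative at `p` of the preferred chart at `p`. -/
def chartDeriv (p : M) : TangentSpace (𝓡 4) p →L[ℝ] E4 :=
  mfderiv (𝓡 4) 𝓘(ℝ, E4) (extChartAt (𝓡 4) p) p

/-- The expression of a differential form in the preferred chart at `p`. -/
def formInChart {k : ℕ} (p : M) (τ : Form M k) (y : E4) : E4 [⋀^Fin k]→L[ℝ] ℝ :=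
  (τ ((extChartAt (𝓡 4) p).symm y)).compContinuousLinearMap (chartSymmDeriv p y)

/-- The expression of a vector field in the preferred chart at `p`. -/
def fieldInChart (p : M) (X : VField M) (y : E4) : E4 :=
  VectorField.mpullback 𝓘(ℝ, E4) (𝓡 4) (extChartAt (𝓡 4) p).symm X y

/-- The form `τ` is smooth: its expression in each chart is. -/
def IsSmoothForm {k : ℕ} (τ : Form M k) : Prop :=
  ∀ p : M, ContDiffOn ℝ ∞ (formInChart p τ) (extChartAt (𝓡 4) p).target

/-- The vector field `X` is a smooth section of the tangent bundle. -/
def IsSmoothField [IsManifold (𝓡 4) ∞ M] (X : VField M) : Prop :=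
  ContMDiff (𝓡 4) (𝓡 4).tangent ∞ (fun p => (⟨p, X p⟩ : TangentBundle (𝓡 4) M))

/-- The exterior derivative of a differential form, computed at `p` in the preferred chart
at `p`. -/
def extD {k : ℕ} (τ : Form M k) : Form M (k + 1) := fun p =>
  (extDeriv (formInChart p τ) (extChartAt (𝓡 4) p p)).compContinuousLinearMap (chartDeriv p)

/-- Fields of (bilinear) functions of two tangent vectors. -/
abbrev Tensor2 (M : Type*) [TopologicalSpace M] [ChartedSpace E4 M] : Type _ :=
  ∀ p : M, TangentSpace (𝓡 4) p → TangentSpace (𝓡 4) p → ℝ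

/-- The expression of a covariant 2-tensor field in the preferred chart at `p`. -/
def tensorInChart (p : M) (T : Tensor2 M) (y : E4) (u v : E4) : ℝ :=
  T ((extChartAt (𝓡 4) p).symm y) (chartSymmDeriv p y u) (chartSymmDeriv p y v)

/-- The Lie derivative of a covariant 2-tensor field, computed at `p` in the preferred chart
at `p`: `(L_X T)_{μν} = X^ρ ∂_ρ T_{μν} + (∂_μ X^ρ) T_{ρν} + (∂_ν X^ρ) T_{μρ}`. -/
def lieD (X : VField M) (T : Tensor2 M) : Tensor2 M := fun p u v =>
  let y : E4 := extChartAt (𝓡 4) p p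
  let Y : E4 → E4 := fieldInChart p X
  let a : E4 := chartDeriv p u
  let b : E4 := chartDeriv p v
  fderiv ℝ (fun z => tensorInChart p T z a b) y (Y y)
    + tensorInChart p T y (fderiv ℝ Y y a) b
    + tensorInChart p T y a (fderiv ℝ Y y b)

/-- A smooth `SU(2)` structure on `M`. -/
structure IsSU2Structure (S : Fin 3 → Form M 2) : Prop where
  smooth : ∀ i, IsSmoothForm (S i)
  triple : ∀ p, IsSU2Triple (fun i => S i p)

/-- `L_X Σ^i = ε^{ijk} θ̃^j Σ^k`. -/
def IsSigmaKilling (S : Fin 3 → Form M 2) (X : VField M) (θt : Fin 3 → M → ℝ) : Prop :=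
  ∀ i p u v, lieD X (fun q => ev2 (S i q)) p u v =
    ∑ j, ∑ k, eps i j k * θt j p * ev2 (S k p) u v

/-- Smooth Riemannian metrics on `M`. -/
abbrev Metric (M : Type*) [TopologicalSpace M] [ChartedSpace E4 M] [IsManifold (𝓡 4) ∞ M] :=
  Bundle.ContMDiffRiemannianMetric (𝓡 4) ∞ E4 (fun p : M => TangentSpace (𝓡 4) p)

/-- `X` is a Killing vector field of the metric `g`: `L_X g = 0`. -/
def IsKilling [IsManifold (𝓡 4) ∞ M] (g : Metric M) (X : VField M) : Prop :=
  ∀ p u v, lieD X (fun q u v => g.inner q u v) p u v = 0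

/-- The 1-form `X^♭ = g(X, ·)`. -/
def flat [IsManifold (𝓡 4) ∞ M] (g : Metric M) (X : VField M) : CovectorField M :=
  fun p => g.inner p (X p)

/-- `A^i` is the `Σ`-compatible connection: `dΣ^i + ε^{ijk} A^j ∧ Σ^k = 0`. -/
def IsCompatible (S : Fin 3 → Form M 2) (A : Fin 3 → CovectorField M) : Prop :=
  ∀ i p u v w, extD (S i) p ![u, v, w] +
    ∑ j, ∑ k, eps i j k * wedge12 (A j p) (ev2 (S k p)) u v w = 0

/-- The exterior covariant derivative `d^A β^i = dβ^i + ε^{ijk} A^j ∧ β^k` of a triple of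
1-forms. -/
def covD (A β : Fin 3 → CovectorField M) (i : Fin 3) : Tensor2 M := fun p u v =>
  ev2 (extD (CovectorField.toForm (β i)) p) u v +
    ∑ j, ∑ k, eps i j k * wedge11 (A j p) (β k p) u v

end Manifold

end SigmaKilling

end

open SigmaKilling

noncomputable section

namespace SigmaKilling

open Matrix

/-! ### Skew-symmetric 4 by 4 matrices -/

/-! In a frame, a 2-form is a skew matrix `A`, and `A * dualMat A` is minus the Pfaffian of `A`
times the identity. Polarising this (`mul_dualMat_add`) turns Σ^i ∧ Σ^j = δ^{ij} μ into
Clifford-type relations: `s i * dualMat (s i) = -m • 1`, and distinct indices anticommute. All six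
terms of the cubic formula for g then agree with `cubic s`. Comparing determinants, with vol² = det
G, gives m G = σ cubic(s) with σ = ±1 (`exists_metric_eq_cubic`). By continuity σ is constant near
each point (`exists_isLocalMetric`), so the metric is an explicit function of the triple there.

Killing: differentiate m G = σ cubic(s) along X. Infinitesimal rotations of the triple drop out of
both m and the cubic (`IsTriple.cubic_variation`, `IsTriple.pairing_variation`), and the density
weights, multiples of the trace of the Jacobian of X, cancel. Hence L_X g = 0
(`IsLocalMetric.dirDeriv_metric`).

Covariant derivative: this is Cartan's formula L_X = dι_X + ι_X d, with dΣ^i eliminated by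
compatibility (`cartan_triple`).

Self-dual part: the Clifford relations give Σ^i ∧ X^♭ = σ Σ^{i+1} ∧ ι_X Σ^{i+2}, indices mod 3. In
its exterior derivative, dΣ is replaced through A and dι_XΣ through the previous formula. All A
terms cancel, leaving Σ^i ∧ dX^♭ as a multiple of θ^i (`IsTriple.pairing_of_divergence`). The
quaternion algebra fixes σ = -1 and makes duals in an orthonormal frame multiples of the forms,
which yields the contraction formula. The star formula follows because the triple spans the
self-dual forms (`IsTriple.eq_zero_of_pairing`). -/

/-- Real 4 by 4 matrices. -/
abbrev Mat4 : Type := Matrix (Fin 4) (Fin 4) ℝ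

/-- The dual `½ ε^{abcd} A_{cd}` of a skew-symmetric matrix. -/
def dualMat (A : Mat4) : Mat4 :=
  !![0, A 2 3, -A 1 3, A 1 2;
    -A 2 3, 0, A 0 3, -A 0 2;
    A 1 3, -A 0 3, 0, A 0 1;
    -A 1 2, A 0 2, -A 0 1, 0]

/-- The coefficient of the wedge product of the 2-forms with the given matrices. -/
def pairing (A B : Mat4) : ℝ :=
  A 0 1 * B 2 3 - A 0 2 * B 1 3 + A 0 3 * B 1 2 + A 1 2 * B 0 3 - A 1 3 * B 0 2 + A 2 3 * B 0 1

/-- The skew-symmetric matrix with the given entries. -/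
def skewMat (a b c d e f : ℝ) : Mat4 :=
  !![0, a, b, c; -a, 0, d, e; -b, -d, 0, f; -c, -e, -f, 0]

/-- Six free parameters turn the identities below into polynomial identities, checked entry by
entry. -/
theorem exists_eq_skewMat {A : Mat4} (hA : Aᵀ = -A) : ∃ a b c d e f, A = skewMat a b c d e f := by
  have h : ∀ i j, A j i = -A i j := fun i j => congrFun (congrFun hA i) j
  refine ⟨A 0 1, A 0 2, A 0 3, A 1 2, A 1 3, A 2 3, ?_⟩
  ext i j
  fin_cases i <;> fin_cases j <;> simp [skewMat] <;>
    first
    | exact h _ _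
    | linarith [h 0 0, h 1 1, h 2 2, h 3 3]

theorem dualMat_transpose (A : Mat4) : (dualMat A)ᵀ = -dualMat A := by
  ext i j
  fin_cases i <;> fin_cases j <;> simp [dualMat]

theorem dualMat_add (A B : Mat4) : dualMat (A + B) = dualMat A + dualMat B := by
  ext i j
  fin_cases i <;> fin_cases j <;> simp [dualMat] <;> ring

theorem dualMat_smul (c : ℝ) (A : Mat4) : dualMat (c • A) = c • dualMat A := by
  ext i j
  fin_cases i <;> fin_cases j <;> simp [dualMat]

theorem dualMat_neg (A : Mat4) : dualMat (-A) = -dualMat A := by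
  simpa using dualMat_smul (-1) A

theorem dualMat_sub (A B : Mat4) : dualMat (A - B) = dualMat A - dualMat B := by
  rw [sub_eq_add_neg, dualMat_add, dualMat_neg, sub_eq_add_neg]

theorem pairing_comm (A B : Mat4) : pairing A B = pairing B A := by
  simp only [pairing]; ring

theorem pairing_add (A B C : Mat4) : pairing A (B + C) = pairing A B + pairing A C := by
  simp only [pairing, Matrix.add_apply]; ring

theorem pairing_sub (A B C : Mat4) : pairing A (B - C) = pairing A B - pairing A C := by
  simp only [pairing, Matrix.sub_apply]; ring

theorem pairing_smul (A B : Mat4) (c : ℝ) : pairing A (c • B) = c * pairing A B := by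
  simp only [pairing, Matrix.smul_apply, smul_eq_mul]; ring

/-- Polarisation of the Pfaffian adjugate identity; `pairing A A / 2` is the Pfaffian. This is the
source of all the Clifford relations. -/
theorem mul_dualMat_add {A B : Mat4} (hA : Aᵀ = -A) (hB : Bᵀ = -B) :
    A * dualMat B + B * dualMat A = -pairing A B • (1 : Mat4) := by
  obtain ⟨a, b, c, d, e, f, rfl⟩ := exists_eq_skewMat hA
  obtain ⟨a', b', c', d', e', f', rfl⟩ := exists_eq_skewMat hB
  ext i j
  fin_cases i <;> fin_cases j <;>
    simp [dualMat, skewMat, pairing] <;> ring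

theorem dualMat_mul_add {A B : Mat4} (hA : Aᵀ = -A) (hB : Bᵀ = -B) :
    dualMat A * B + dualMat B * A = -pairing A B • (1 : Mat4) := by
  have h := congrArg transpose (mul_dualMat_add hA hB)
  simp only [transpose_add, transpose_mul, dualMat_transpose, hA, hB, transpose_smul,
    transpose_one, neg_mul_neg] at h
  rw [← h, add_comm]

/-- The dual of a 2-form is a bivector density: the trace is its weight, and the other two terms are
the contravariant action of `B`. -/
theorem dualMat_action {A : Mat4} (hA : Aᵀ = -A) (B : Mat4) :
    dualMat (Bᵀ * A + A * B) = B.trace • dualMat A - B * dualMat A - dualMat A * Bᵀ := by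
  obtain ⟨a, b, c, d, e, f, rfl⟩ := exists_eq_skewMat hA
  ext i j
  fin_cases i <;> fin_cases j <;>
    simp [dualMat, skewMat, Matrix.mul_apply, Fin.sum_univ_four, Matrix.trace, Matrix.vecMul,
      dotProduct] <;> ring

/-- Linearisation at the identity of Pf(PᵀAP) = det P · Pf A. -/
theorem pairing_self_action {A : Mat4} (hA : Aᵀ = -A) (B : Mat4) :
    pairing A (Bᵀ * A + A * B) = B.trace * (pairing A A / 2) := by
  obtain ⟨a, b, c, d, e, f, rfl⟩ := exists_eq_skewMat hA
  simp [pairing, skewMat, Matrix.mul_apply, Fin.sum_univ_four, Matrix.trace, Matrix.vecMul,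
    dotProduct]; ring

theorem det_skew {A : Mat4} (hA : Aᵀ = -A) : A.det = (pairing A A / 2) ^ 2 := by
  obtain ⟨a, b, c, d, e, f, rfl⟩ := exists_eq_skewMat hA
  simp [pairing, skewMat, Matrix.det_succ_row_zero, Fin.sum_univ_succ, Fin.succAbove]; ring

theorem pairing_dualMat (A B : Mat4) : pairing (dualMat A) (dualMat B) = pairing A B := by
  simp [pairing, dualMat]; ring

/-- The matrices of an `SU(2)` triple in a frame. -/
structure IsTriple (s : Fin 3 → Mat4) (m : ℝ) : Prop where
  skew : ∀ i, (s i)ᵀ = -s i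
  pairing_eq : ∀ i j, pairing (s i) (s j) = if i = j then 2 * m else 0

/-- The cubic expression in a triple which is proportional to the metric. -/
def cubic (s : Fin 3 → Mat4) : Mat4 := s 0 * dualMat (s 1) * s 2

theorem eps_sum (i : Fin 3) (f : Fin 3 → Fin 3 → ℝ) :
    ∑ j, ∑ k, eps i j k * f j k = f (i + 1) (i + 2) - f (i + 2) (i + 1) := by
  fin_cases i <;> simp [Fin.sum_univ_three, eps] <;> norm_num <;> ring

/-! ### Clifford relations of a triple, and the cubic expression -/

namespace IsTriple

variable {s : Fin 3 → Mat4} {m : ℝ}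

theorem mul_dual_self (h : IsTriple s m) (i : Fin 3) : s i * dualMat (s i) = -m • (1 : Mat4) := by
  have h1 := mul_dualMat_add (h.skew i) (h.skew i)
  rw [h.pairing_eq, if_pos rfl, ← two_smul ℝ, neg_smul, mul_smul, ← smul_neg] at h1
  rw [smul_right_injective _ (two_ne_zero (α := ℝ)) h1, neg_smul]

theorem dual_mul_self (h : IsTriple s m) (i : Fin 3) : dualMat (s i) * s i = -m • (1 : Mat4) := by
  have h1 := dualMat_mul_add (h.skew i) (h.skew i)
  rw [h.pairing_eq, if_pos rfl, ← two_smul ℝ, neg_smul, mul_smul, ← smul_neg] at h1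
  rw [smul_right_injective _ (two_ne_zero (α := ℝ)) h1, neg_smul]

theorem mul_dual_swap (h : IsTriple s m) {i j : Fin 3} (hij : i ≠ j) :
    s i * dualMat (s j) = -(s j * dualMat (s i)) := by
  have h1 := mul_dualMat_add (h.skew i) (h.skew j)
  rw [h.pairing_eq, if_neg hij, neg_zero, zero_smul] at h1
  exact eq_neg_of_add_eq_zero_left h1

theorem dual_mul_swap (h : IsTriple s m) {i j : Fin 3} (hij : i ≠ j) :
    dualMat (s i) * s j = -(dualMat (s j) * s i) := by
  have h1 := dualMat_mul_add (h.skew i) (h.skew j)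
  rw [h.pairing_eq, if_neg hij, neg_zero, zero_smul] at h1
  exact eq_neg_of_add_eq_zero_left h1

/-- A cyclic shift amounts to two anticommutations, so the signs cancel. -/
theorem cubic_eq (h : IsTriple s m) (i : Fin 3) :
    s i * dualMat (s (i + 1)) * s (i + 2) = cubic s := by
  have h1 : s 1 * dualMat (s 2) * s 0 = cubic s := by
    rw [cubic, h.mul_dual_swap (show (0 : Fin 3) ≠ 1 by decide), neg_mul, Matrix.mul_assoc,
      h.dual_mul_swap (show (2 : Fin 3) ≠ 0 by decide), mul_neg, Matrix.mul_assoc]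
  have h2 : s 2 * dualMat (s 0) * s 1 = cubic s := by
    rw [cubic, Matrix.mul_assoc (s 0), h.dual_mul_swap (show (1 : Fin 3) ≠ 2 by decide), mul_neg,
      ← Matrix.mul_assoc, h.mul_dual_swap (show (0 : Fin 3) ≠ 2 by decide), neg_mul, neg_neg]
  fin_cases i
  · rfl
  · exact h1
  · exact h2

theorem det_cubic (h : IsTriple s m) : (cubic s).det = m ^ 6 := by
  have h1 : ∀ i, (s i).det = m ^ 2 := fun i => by
    rw [det_skew (h.skew i), h.pairing_eq, if_pos rfl]; ring
  have h2 : (dualMat (s 1)).det = m ^ 2 := by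
    rw [det_skew (dualMat_transpose _), pairing_dualMat, h.pairing_eq, if_pos rfl]; ring
  rw [cubic, det_mul, det_mul, h1, h1, h2]; ring

/-- Applied to a vector, this becomes the identity between Σ^i ∧ X^♭ and Σ^{i+1} ∧ ι_X Σ^{i+2}. -/
theorem dual_mul_cubic (h : IsTriple s m) (i : Fin 3) :
    dualMat (s i) * cubic s = -m • (dualMat (s (i + 1)) * s (i + 2)) := by
  rw [← h.cubic_eq i, ← Matrix.mul_assoc, ← Matrix.mul_assoc, h.dual_mul_self, smul_mul_assoc,
    smul_mul_assoc, Matrix.one_mul]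

/-- The variation of the cubic expression under a linear map and a rotation of the triple. -/
theorem cubic_variation (h : IsTriple s m) (B : Mat4) (t : Fin 3 → ℝ) (r : Fin 3 → Mat4)
    (hr : ∀ i, r i = -(Bᵀ * s i + s i * B) + (t (i + 1) • s (i + 2) - t (i + 2) • s (i + 1))) :
    r 0 * dualMat (s 1) * s 2 + s 0 * dualMat (r 1) * s 2 + s 0 * dualMat (s 1) * r 2 =
      -(Bᵀ * cubic s) - cubic s * B - B.trace • cubic s := by
  have e0 := hr 0
  have e1 := hr 1
  have e2 := hr 2
  simp only [show (0 : Fin 3) + 1 = 1 from rfl, show (0 : Fin 3) + 2 = 2 from rfl,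
    show (1 : Fin 3) + 1 = 2 from rfl, show (1 : Fin 3) + 2 = 0 from rfl,
    show (2 : Fin 3) + 1 = 0 from rfl, show (2 : Fin 3) + 2 = 1 from rfl] at e0 e1 e2
  have d1 : dualMat (r 1) = -(B.trace • dualMat (s 1) - B * dualMat (s 1) - dualMat (s 1) * Bᵀ)
      + (t 2 • dualMat (s 0) - t 0 • dualMat (s 2)) := by
    rw [e1, dualMat_add, dualMat_neg, dualMat_action (h.skew 1), dualMat_sub, dualMat_smul,
      dualMat_smul]
  -- The rotation part produces only products with a repeated index; `a1` to `a6` reduce each to a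
  -- multiple of one form, and these cancel in pairs.
  have a1 : s 2 * dualMat (s 1) * s 2 = m • s 1 := by
    rw [h.mul_dual_swap (show (2 : Fin 3) ≠ 1 by decide), neg_mul, Matrix.mul_assoc,
      h.dual_mul_self, neg_smul, mul_neg, neg_neg, mul_smul_comm, Matrix.mul_one]
  have a2 : s 0 * dualMat (s 1) * s 0 = m • s 1 := by
    rw [h.mul_dual_swap (show (0 : Fin 3) ≠ 1 by decide), neg_mul, Matrix.mul_assoc,
      h.dual_mul_self, neg_smul, mul_neg, neg_neg, mul_smul_comm, Matrix.mul_one]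
  have a3 : s 1 * dualMat (s 1) * s 2 = -m • s 2 := by
    rw [h.mul_dual_self, smul_mul_assoc, Matrix.one_mul]
  have a4 : s 0 * dualMat (s 0) * s 2 = -m • s 2 := by
    rw [h.mul_dual_self, smul_mul_assoc, Matrix.one_mul]
  have a5 : s 0 * dualMat (s 2) * s 2 = -m • s 0 := by
    rw [Matrix.mul_assoc, h.dual_mul_self, mul_smul_comm, Matrix.mul_one]
  have a6 : s 0 * dualMat (s 1) * s 1 = -m • s 0 := by
    rw [Matrix.mul_assoc, h.dual_mul_self, mul_smul_comm, Matrix.mul_one]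
  have key : r 0 * dualMat (s 1) * s 2 + s 0 * dualMat (r 1) * s 2 + s 0 * dualMat (s 1) * r 2 =
      -(Bᵀ * cubic s) - cubic s * B - B.trace • cubic s
      + (t 1 • (s 2 * dualMat (s 1) * s 2) - t 2 • (s 1 * dualMat (s 1) * s 2)
      + (t 2 • (s 0 * dualMat (s 0) * s 2) - t 0 • (s 0 * dualMat (s 2) * s 2))
      + (t 0 • (s 0 * dualMat (s 1) * s 1) - t 1 • (s 0 * dualMat (s 1) * s 0))) := by
    rw [d1, e0, e2, cubic]
    simp only [add_mul, mul_add, sub_mul, mul_sub, neg_mul, mul_neg, smul_mul_assoc,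
      mul_smul_comm, Matrix.mul_assoc]
    abel
  rw [key, a1, a2, a3, a4, a5, a6]
  abel

/-- The rotation moves `s 0` in directions orthogonal to it, so only the density weight of the
Pfaffian survives. -/
theorem pairing_variation (h : IsTriple s m) (B : Mat4) (t : Fin 3 → ℝ) (r : Fin 3 → Mat4)
    (hr : ∀ i, r i = -(Bᵀ * s i + s i * B) + (t (i + 1) • s (i + 2) - t (i + 2) • s (i + 1))) :
    pairing (s 0) (r 0) = -(B.trace * m) := by
  have e1 : pairing (s 0) (s (0 + 1)) = 0 := by rw [h.pairing_eq]; rfl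
  have e2 : pairing (s 0) (s (0 + 2)) = 0 := by rw [h.pairing_eq]; rfl
  rw [hr, ← neg_one_smul ℝ, pairing_add, pairing_sub, pairing_smul, pairing_smul, pairing_smul,
    pairing_self_action (h.skew 0), e1, e2, h.pairing_eq, if_pos rfl]
  ring

end IsTriple

/-! ### Forms and metrics in a frame -/

section Frame

variable {V : Type*} [AddCommGroup V] [Module ℝ V] [TopologicalSpace V]

/-- The matrix of a 2-form in a frame. -/
def formMat (τ : V [⋀^Fin 2]→L[ℝ] ℝ) (e : Fin 4 → V) : Mat4 := of fun a b => ev2 τ (e a) (e b)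

/-- The Gram matrix of a bilinear form in a frame. -/
def gramMat (g : V →L[ℝ] V →L[ℝ] ℝ) (e : Fin 4 → V) : Mat4 := of fun a b => g (e a) (e b)

theorem ev2_swap (τ : V [⋀^Fin 2]→L[ℝ] ℝ) (u v : V) : ev2 τ v u = -ev2 τ u v := by
  have h := τ.toAlternatingMap.map_swap ![u, v] (show (0 : Fin 2) ≠ 1 by decide)
  have h2 : ![u, v] ∘ Equiv.swap (0 : Fin 2) 1 = ![v, u] := by
    funext i; fin_cases i <;> simp
  rw [h2] at h
  exact h

theorem formMat_transpose (τ : V [⋀^Fin 2]→L[ℝ] ℝ) (e : Fin 4 → V) :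
    (formMat τ e)ᵀ = -formMat τ e := by
  ext a b
  exact ev2_swap τ (e a) (e b)

theorem wedge22_frame (τ η : V [⋀^Fin 2]→L[ℝ] ℝ) (e : Fin 4 → V) :
    wedge22 (ev2 τ) (ev2 η) (e 0) (e 1) (e 2) (e 3) = pairing (formMat τ e) (formMat η e) := rfl

/-- The minus sign comes from transposing the matrix of `T`, whose free index is its first one. -/
theorem wedge22_wedge11_frame (S T U : V [⋀^Fin 2]→L[ℝ] ℝ) (e : Fin 4 → V) (a b : Fin 4) :
    wedge22 (wedge11 (interior2 (e a) S) (interior2 (e b) T)) (ev2 U) (e 0) (e 1) (e 2) (e 3) =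
      -(formMat S e * dualMat (formMat U e) * formMat T e) a b := by
  have h : formMat T e = -(formMat T e)ᵀ := by rw [formMat_transpose, neg_neg]
  rw [h]
  simp only [wedge22, wedge11, interior2_apply, Matrix.mul_apply, Fin.sum_univ_four]
  simp [formMat, dualMat]
  ring

theorem isTriple_of_isSU2Triple {S : Fin 3 → V [⋀^Fin 2]→L[ℝ] ℝ} (hS : IsSU2Triple S)
    (e : Module.Basis (Fin 4) ℝ V) : ∃ m, m ≠ 0 ∧ IsTriple (fun i => formMat (S i) e) m := by
  obtain ⟨μ, hμ, h⟩ := hS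
  have hb : (![e 0, e 1, e 2, e 3] : Fin 4 → V) = e := by
    funext i; fin_cases i <;> rfl
  refine ⟨μ e / 2, ?_, fun i => formMat_transpose _ _, fun i j => ?_⟩
  · have h0 : μ.toAlternatingMap ≠ 0 := fun h0 =>
      hμ (ContinuousAlternatingMap.toAlternatingMap_injective h0)
    exact div_ne_zero ((AlternatingMap.map_basis_ne_zero_iff e _).2 h0) two_ne_zero
  · rw [← wedge22_frame, h, hb]
    ring_nf

open scoped MatrixOrder in
-- Factor the positive definite Gram matrix as BᵀB; the columns of B⁻¹ give the frame.
theorem exists_orthonormalFrame {g : V →L[ℝ] V →L[ℝ] ℝ} (hsymm : ∀ u v, g u v = g v u)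
    (hpos : ∀ u, u ≠ 0 → 0 < g u u) (e : Module.Basis (Fin 4) ℝ V) :
    ∃ (b : Fin 4 → V) (C : Mat4), IsOrthonormalFrame g b ∧ (∀ i, b i = ∑ a, C a i • e a) ∧
      (gramMat g e).det * C.det ^ 2 = 1 := by
  have hexp : ∀ x y : Fin 4 → ℝ, g (∑ a, x a • e a) (∑ a, y a • e a) =
      x ⬝ᵥ (gramMat g e *ᵥ y) := fun x y => by
    simp only [map_sum, map_smul, _root_.sum_apply, _root_.smul_apply,
      smul_eq_mul, dotProduct, mulVec, gramMat, of_apply, Finset.mul_sum]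
    rw [Finset.sum_comm]
    exact Finset.sum_congr rfl fun _ _ => Finset.sum_congr rfl fun _ _ => by ring
  have hpd : (gramMat g e).PosDef := by
    refine Matrix.PosDef.of_dotProduct_mulVec_pos ?_ fun x hx => ?_
    · ext a b
      exact hsymm (e b) (e a)
    · rw [star_trivial, ← hexp]
      refine hpos _ fun h0 => hx ?_
      funext a
      have := congrArg (fun v => e.repr v a) h0
      simpa [Finsupp.single_apply] using this
  obtain ⟨B, hB⟩ := CStarAlgebra.nonneg_iff_eq_star_mul_self.1 hpd.posSemidef.nonneg
  rw [star_eq_conjTranspose, conjTranspose_eq_transpose_of_trivial] at hB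
  have hdet : (gramMat g e).det = B.det ^ 2 := by rw [hB, det_mul, det_transpose, sq]
  have hB0 : B.det ≠ 0 := fun h0 => hpd.det_pos.ne' (by rw [hdet, h0]; ring)
  have hu : IsUnit B.det := isUnit_iff_ne_zero.2 hB0
  refine ⟨fun i => ∑ a, B⁻¹ a i • e a, B⁻¹, fun i j => ?_, fun _ => rfl, ?_⟩
  · rw [hexp]
    have h1 : (B⁻¹)ᵀ * (gramMat g e * B⁻¹) = 1 := by
      rw [hB, Matrix.mul_assoc, mul_nonsing_inv B hu, Matrix.mul_one, ← transpose_mul,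
        mul_nonsing_inv B hu, transpose_one]
    have h2 := congrFun (congrFun h1 i) j
    rw [one_apply] at h2
    exact h2
  · rw [hdet, ← mul_pow, ← det_mul, mul_nonsing_inv B hu, det_one, one_pow]

theorem sq_vol_eq_det {g : V →L[ℝ] V →L[ℝ] ℝ} (hsymm : ∀ u v, g u v = g v u)
    (hpos : ∀ u, u ≠ 0 → 0 < g u u) (e : Module.Basis (Fin 4) ℝ V) {vol : V [⋀^Fin 4]→L[ℝ] ℝ}
    (hvol : IsVolumeForm g vol) : vol e ^ 2 = (gramMat g e).det := by
  obtain ⟨b, C, hb, hC, hdet⟩ := exists_orthonormalFrame hsymm hpos e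
  have h1 := hvol b hb
  have h2 : vol b = vol e * C.det := by
    have h3 := congrArg (fun f => f b) (vol.toAlternatingMap.eq_smul_basis_det e)
    have h4 : e.toMatrix b = C := by
      ext i j
      simp [Module.Basis.toMatrix_apply, hC, Finsupp.single_apply]
    simpa [Module.Basis.det_apply, h4] using h3
  have h5 : (vol e * C.det) ^ 2 = 1 := by rw [← h2, ← sq_abs, h1, one_pow]
  have h6 : C.det ^ 2 ≠ 0 := fun h0 => by rw [h0] at hdet; simp at hdet
  exact mul_right_cancel₀ h6 (by rw [hdet, ← mul_pow, h5])

/-- In every frame, the metric of an `SU(2)` triple is a multiple of the cubic expression. -/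
theorem exists_metric_eq_cubic {S : Fin 3 → V [⋀^Fin 2]→L[ℝ] ℝ} {g : V →L[ℝ] V →L[ℝ] ℝ}
    (hS : IsSU2Triple S) (hg : IsMetricOf S g) (hsymm : ∀ u v, g u v = g v u)
    (hpos : ∀ u, u ≠ 0 → 0 < g u u) (e : Module.Basis (Fin 4) ℝ V) :
    ∃ m σ : ℝ, m ≠ 0 ∧ σ ^ 2 = 1 ∧ IsTriple (fun i => formMat (S i) e) m ∧
      m • gramMat g e = σ • cubic (fun i => formMat (S i) e) := by
  obtain ⟨m, hm, ht⟩ := isTriple_of_isSU2Triple hS e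
  obtain ⟨vol, hvol, hgv⟩ := hg
  have hb : (![e 0, e 1, e 2, e 3] : Fin 4 → V) = e := by
    funext i; fin_cases i <;> rfl
  have h1 : vol e • gramMat g e = cubic (fun i => formMat (S i) e) := by
    ext a b
    have h2 := hgv (e a) (e b) (e 0) (e 1) (e 2) (e 3)
    rw [hb] at h2
    simp only [wedge22_wedge11_frame] at h2
    rw [Matrix.smul_apply, smul_eq_mul, mul_comm]
    refine h2.trans ?_
    -- For each `i` the two permutations contribute one cubic each, so the six terms absorb the
    -- factor 1/6.
    have h3 : ∀ i, ∑ j, ∑ k, eps i j k *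
        -(formMat (S i) e * dualMat (formMat (S k) e) * formMat (S j) e) a b =
        2 * cubic (fun i => formMat (S i) e) a b := fun i => by
      rw [eps_sum i fun j k =>
        -(formMat (S i) e * dualMat (formMat (S k) e) * formMat (S j) e) a b]
      have h4 := ht.dual_mul_swap (show i + 2 ≠ i + 1 by fin_cases i <;> decide)
      have h5 := ht.cubic_eq i
      have h6 : formMat (S i) e * dualMat (formMat (S (i + 2)) e) * formMat (S (i + 1)) e =
          -cubic (fun i => formMat (S i) e) := by
        rw [Matrix.mul_assoc, h4, mul_neg, ← Matrix.mul_assoc, h5]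
      rw [h6, h5, neg_apply]
      ring
    simp only [h3, Finset.sum_const, Finset.card_univ, Fintype.card_fin, nsmul_eq_mul]
    push_cast
    ring
  have h2 := sq_vol_eq_det hsymm hpos e hvol
  -- Determinants of vol · G = cubic: the left side is vol⁴ det G = vol⁶.
  have h3 : (vol e) ^ 6 = m ^ 6 := by
    rw [← ht.det_cubic, ← h1, det_smul, ← h2, Fintype.card_fin]; ring
  have h4 : (vol e) ^ 2 = m ^ 2 := by
    have h5 : ((vol e) ^ 2) ^ 3 = (m ^ 2) ^ 3 := by rw [← pow_mul, ← pow_mul, h3]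
    exact (pow_left_inj₀ (sq_nonneg _) (sq_nonneg _) three_ne_zero).1 h5
  have hv : vol e ≠ 0 := fun h0 => hm (by simpa [h0] using h4.symm)
  refine ⟨m, m / vol e, hm, ?_, ht, ?_⟩
  · rw [div_pow, h4, div_self (pow_ne_zero _ hm)]
  · rw [← h1, smul_smul, div_mul_cancel₀ _ hv]

end Frame

/-! ### Divergences of dual matrices -/

theorem fin3_add_one_add_one (i : Fin 3) : i + 1 + 1 = i + 2 := by fin_cases i <;> rfl
theorem fin3_add_one_add_two (i : Fin 3) : i + 1 + 2 = i := by fin_cases i <;> rfl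
theorem fin3_add_two_add_one (i : Fin 3) : i + 2 + 1 = i := by fin_cases i <;> rfl
theorem fin3_add_two_add_two (i : Fin 3) : i + 2 + 2 = i + 1 := by fin_cases i <;> rfl
theorem fin3_ne_add_one (i : Fin 3) : i ≠ i + 1 := by fin_cases i <;> decide
theorem fin3_ne_add_two (i : Fin 3) : i ≠ i + 2 := by fin_cases i <;> decide

/-- The matrix of the wedge product of two covectors. -/
def wedgeMat (α β : Fin 4 → ℝ) : Mat4 := of fun a b => α a * β b - α b * β a

theorem pairing_wedgeMat (s : Mat4) (α β : Fin 4 → ℝ) :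
    pairing s (wedgeMat α β) = α ⬝ᵥ (dualMat s *ᵥ β) := by
  simp [pairing, wedgeMat, dualMat, dotProduct, mulVec, Fin.sum_univ_four]
  ring

/-- With `M` the matrix of partial derivatives of a 1-form α, the right side is the coefficient of Σ
∧ dα. -/
theorem sum_dualMat_mul (s M : Mat4) :
    ∑ c, ∑ b, dualMat s c b * M c b = pairing s (M - Mᵀ) := by
  simp [pairing, dualMat, Fin.sum_univ_four]
  ring

theorem dualMat_mulVec_dotProduct (s : Mat4) (x y : Fin 4 → ℝ) :
    (dualMat s *ᵥ x) ⬝ᵥ y = -(x ⬝ᵥ (dualMat s *ᵥ y)) := by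
  have h : x ᵥ* dualMat s = -(dualMat s *ᵥ x) := by
    rw [← vecMul_transpose, dualMat_transpose, vecMul_neg, neg_neg]
  rw [dotProduct_mulVec, h, neg_dotProduct, neg_neg]

/-- The divergence of the dual matrices of a 2-form whose exterior derivative is
`-(A ∧ S - B ∧ T)`. -/
theorem sum_dualMat_of_closed (D : Fin 4 → Mat4) (S T : Mat4) (A B : Fin 4 → ℝ)
    (h : ∀ a b c, D a b c - D b a c + D c a b +
      ((A a * S b c - A b * S a c + A c * S a b) - (B a * T b c - B b * T a c + B c * T a b)) = 0)
    (b : Fin 4) :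
    ∑ c, dualMat (D c) c b = (dualMat S *ᵥ A) b - (dualMat T *ᵥ B) b := by
  fin_cases b <;> simp [dualMat, mulVec, dotProduct, Fin.sum_univ_four]
  · linear_combination -h 1 2 3
  · linear_combination h 0 2 3
  · linear_combination -h 0 1 3
  · linear_combination h 0 1 2

theorem sum_sum_dualMat_of_closed (D : Fin 4 → Mat4) (S T : Mat4) (A B : Fin 4 → ℝ)
    (h : ∀ a b c, D a b c - D b a c + D c a b +
      ((A a * S b c - A b * S a c + A c * S a b) - (B a * T b c - B b * T a c + B c * T a b)) = 0)
    (x : Fin 4 → ℝ) :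
    ∑ c, ∑ b, dualMat (D c) c b * x b = B ⬝ᵥ (dualMat T *ᵥ x) - A ⬝ᵥ (dualMat S *ᵥ x) := by
  have h1 : ∑ c, ∑ b, dualMat (D c) c b * x b = (dualMat S *ᵥ A) ⬝ᵥ x - (dualMat T *ᵥ B) ⬝ᵥ x := by
    rw [Finset.sum_comm, ← sub_dotProduct]
    refine Finset.sum_congr rfl fun b _ => ?_
    rw [← Finset.sum_mul, sum_dualMat_of_closed D S T A B h b, Pi.sub_apply]
  rw [h1, dualMat_mulVec_dotProduct, dualMat_mulVec_dotProduct]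
  ring

/-- Here α is X^♭ and β^i is ι_X Σ^i. The vector `dualMat (s i) *ᵥ α` represents the 3-form Σ^i ∧ α,
and its divergence represents the exterior derivative. Only the values of the connection at the
point enter. -/
theorem IsTriple.pairing_of_divergence {s : Fin 3 → Mat4} {m σ : ℝ} (h : IsTriple s m)
    (D : Fin 4 → Fin 3 → Mat4) (A : Fin 3 → Fin 4 → ℝ) (y α : Fin 4 → ℝ) (Dα : Mat4)
    (β : Fin 3 → Fin 4 → ℝ) (Dβ : Fin 3 → Mat4) (θ : Fin 3 → ℝ)
    (hβ : ∀ i, β i = -(s i *ᵥ y))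
    (hC : ∀ i a b c, D a i b c - D b i a c + D c i a b +
      ((A (i + 1) a * s (i + 2) b c - A (i + 1) b * s (i + 2) a c + A (i + 1) c * s (i + 2) a b) -
       (A (i + 2) a * s (i + 1) b c - A (i + 2) b * s (i + 1) a c + A (i + 2) c * s (i + 1) a b))
      = 0)
    (hα : ∀ i, dualMat (s i) *ᵥ α = σ • (dualMat (s (i + 1)) *ᵥ β (i + 2)))
    (hdiv : ∀ i, ∑ c, ∑ b, (dualMat (D c i) c b * α b + dualMat (s i) c b * Dα c b) =
      σ * ∑ c, ∑ b, (dualMat (D c (i + 1)) c b * β (i + 2) b +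
        dualMat (s (i + 1)) c b * Dβ (i + 2) c b))
    (hDβ : ∀ i, Dβ i - (Dβ i)ᵀ + (wedgeMat (A (i + 1)) (β (i + 2)) -
      wedgeMat (A (i + 2)) (β (i + 1))) = θ (i + 1) • s (i + 2) - θ (i + 2) • s (i + 1))
    (i : Fin 3) : pairing (s i) (Dα - Dαᵀ) = 2 * σ * m * θ i := by
  have hb : ∀ j k, dualMat (s j) *ᵥ β k = -((dualMat (s j) * s k) *ᵥ y) := fun j k => by
    rw [hβ, mulVec_neg, mulVec_mulVec]
  have hb0 : ∀ j, dualMat (s j) *ᵥ β j = m • y := fun j => by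
    rw [hb, h.dual_mul_self, smul_mulVec, one_mulVec, neg_smul, neg_neg]
  have hb1 : ∀ j k, j ≠ k → dualMat (s j) *ᵥ β k = -(dualMat (s k) *ᵥ β j) := fun j k hjk => by
    rw [hb, hb, h.dual_mul_swap hjk, neg_mulVec]
  have e := hdiv i
  simp only [Finset.sum_add_distrib, sum_dualMat_mul] at e
  rw [sum_sum_dualMat_of_closed (fun c => D c i) _ _ _ _ (hC i),
    sum_sum_dualMat_of_closed (fun c => D c (i + 1)) _ _ _ _ (hC (i + 1)), hα, hα] at e
  have f := hDβ (i + 2)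
  rw [← eq_sub_iff_add_eq] at f
  rw [f] at e
  simp only [fin3_add_one_add_one, fin3_add_one_add_two, fin3_add_two_add_one,
    fin3_add_two_add_two, pairing_sub, pairing_smul, pairing_wedgeMat, dotProduct_smul] at e
  -- The `A i` terms cancel because `dualMat (s j) *ᵥ β j = m • y` for every `j`; those in `A (i +
  -- 1)` and `A (i + 2)` cancel by anticommutation.
  rw [hb0, hb0, h.pairing_eq, h.pairing_eq, if_pos rfl, if_neg (fin3_ne_add_one i).symm,
    hb1 _ _ (fin3_ne_add_one i).symm, hb1 _ _ (fin3_ne_add_two i).symm] at e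
  simp only [dotProduct_neg, dotProduct_smul, smul_eq_mul] at e
  rw [pairing_sub]
  linear_combination e

/-- Cartan's formula for a triple whose Lie derivative is an infinitesimal rotation. -/
theorem cartan_triple {s : Fin 3 → Mat4} (hs : ∀ i, (s i)ᵀ = -s i)
    (D : Fin 4 → Fin 3 → Mat4)
    (A : Fin 3 → Fin 4 → ℝ) (y : Fin 4 → ℝ) (B : Mat4)
    (β : Fin 3 → Fin 4 → ℝ) (Dβ : Fin 3 → Mat4) (t θ : Fin 3 → ℝ)
    (hβ : ∀ i b, β i b = ∑ c, y c * s i c b)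
    (hDβ : ∀ i a b, Dβ i a b = ∑ c, (B c a * s i c b + y c * D a i c b))
    (hK : ∀ i, ∑ c, y c • D c i + (Bᵀ * s i + s i * B) =
      t (i + 1) • s (i + 2) - t (i + 2) • s (i + 1))
    (hC : ∀ i a b c, D a i b c - D b i a c + D c i a b +
      ((A (i + 1) a * s (i + 2) b c - A (i + 1) b * s (i + 2) a c + A (i + 1) c * s (i + 2) a b) -
       (A (i + 2) a * s (i + 1) b c - A (i + 2) b * s (i + 1) a c + A (i + 2) c * s (i + 1) a b))
      = 0)
    (hθ : ∀ i, θ i = t i + ∑ c, A i c * y c) (i : Fin 3) :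
    Dβ i - (Dβ i)ᵀ + (wedgeMat (A (i + 1)) (β (i + 2)) -
      wedgeMat (A (i + 2)) (β (i + 1))) = θ (i + 1) • s (i + 2) - θ (i + 2) • s (i + 1) := by
  ext a b
  have h1 := congrFun (congrFun (hK i) a) b
  have hs' : ∀ i c d, s i c d = -s i d c := fun i c d => congrFun (congrFun (hs i) d) c
  simp only [Matrix.add_apply, Matrix.sub_apply, Matrix.smul_apply, transpose_apply,
    Matrix.mul_apply, smul_eq_mul, wedgeMat, of_apply, hDβ, hβ, hθ, Fin.sum_univ_four] at h1 ⊢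
  -- Contract the compatibility equation with `y` and subtract it from the Lie derivative equation;
  -- skewness matches the Jacobian terms.
  linear_combination h1 - y 0 * hC i 0 a b - y 1 * hC i 1 a b - y 2 * hC i 2 a b
    - y 3 * hC i 3 a b - B 0 b * hs' i 0 a - B 1 b * hs' i 1 a
    - B 2 b * hs' i 2 a - B 3 b * hs' i 3 a

/-! ### Self-dual forms in an orthonormal frame -/

/-- The Hodge dual of a skew-symmetric matrix, computed with a totally skew-symmetric 4-tensor. -/
theorem half_sum_alternating (f : Fin 4 → Fin 4 → Fin 4 → Fin 4 → ℝ)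
    (h1 : ∀ a b c d, f b a c d = -f a b c d) (h2 : ∀ a b c d, f a c b d = -f a b c d)
    (h3 : ∀ a b c d, f a b d c = -f a b c d) {F : Mat4} (hF : Fᵀ = -F) (a b : Fin 4) :
    (1 / 2) * ∑ c, ∑ d, f a b c d * F c d = f 0 1 2 3 * dualMat F a b := by
  have z1 : ∀ a c d, f a a c d = 0 := fun a c d => by linarith [h1 a a c d]
  have z2 : ∀ a b d, f a b b d = 0 := fun a b d => by linarith [h2 a b b d]
  have z3 : ∀ a b c, f a b c c = 0 := fun a b c => by linarith [h3 a b c c]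
  have z4 : ∀ a b d, f a b a d = 0 := fun a b d => by rw [h2, z1, neg_zero]
  have z5 : ∀ a b c, f a b c b = 0 := fun a b c => by rw [h3, z2, neg_zero]
  have z6 : ∀ a b c, f a b c a = 0 := fun a b c => by rw [h3, z4, neg_zero]
  have c2 : ∀ a b c d, f a c d b = f a b c d := fun a b c d => by rw [h3, h2, neg_neg]
  have c3 : ∀ a b c d, f a d b c = f a b c d := fun a b c d => by rw [c2, c2]
  have hsk : ∀ i j, F j i = -F i j := fun i j => congrFun (congrFun hF i) j
  have p1 : f 1 0 2 3 = -f 0 1 2 3 := h1 _ _ _ _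
  have p2 : f 2 0 1 3 = f 0 1 2 3 := by rw [h1, h2, neg_neg]
  have p3 : f 3 0 1 2 = -f 0 1 2 3 := by rw [h1, c3]
  have q0 : f 0 2 1 3 = -f 0 1 2 3 := h2 _ _ _ _
  have q1 : f 0 3 1 2 = f 0 1 2 3 := c3 _ _ _ _
  have q2 : f 1 2 0 3 = f 0 1 2 3 := by rw [h2, p1, neg_neg]
  have q3 : f 1 3 0 2 = -f 0 1 2 3 := by rw [c3, p1]
  have q4 : f 2 1 0 3 = -f 0 1 2 3 := by rw [h2, p2]
  have q5 : f 2 3 0 1 = f 0 1 2 3 := by rw [c3, p2]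
  have q6 : f 3 1 0 2 = f 0 1 2 3 := by rw [h2, p3, neg_neg]
  have q7 : f 3 2 0 1 = -f 0 1 2 3 := by rw [c3, p3]
  have k : ∀ a b, (1 / 2) * ∑ c, ∑ d, f a b c d * F c d =
      f a b 0 1 * F 0 1 + f a b 0 2 * F 0 2 + f a b 0 3 * F 0 3 + f a b 1 2 * F 1 2
        + f a b 1 3 * F 1 3 + f a b 2 3 * F 2 3 := fun a b => by
    simp only [Fin.sum_univ_four, z3, h3 a b 0 1, h3 a b 0 2, h3 a b 0 3, h3 a b 1 2, h3 a b 1 3,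
      h3 a b 2 3, hsk 0 1, hsk 0 2, hsk 0 3, hsk 1 2, hsk 1 3, hsk 2 3]
    ring
  rw [k]
  fin_cases a <;> fin_cases b <;>
    simp only [Fin.zero_eta, Fin.mk_one, Fin.reduceFinMk, z1, z2, z4, z5, z6, p1, p2, p3, q0,
      q1, q2, q3, q4, q5, q6, q7] <;>
    simp [dualMat]

theorem dualMat_dualMat {F : Mat4} (hF : Fᵀ = -F) : dualMat (dualMat F) = F := by
  obtain ⟨a, b, c, d, e, f, rfl⟩ := exists_eq_skewMat hF
  ext i j
  fin_cases i <;> fin_cases j <;> simp [dualMat, skewMat]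

/-- A self-dual matrix orthogonal to a self-dual triple vanishes. -/
theorem IsTriple.eq_zero_of_pairing {s : Fin 3 → Mat4} {m ε : ℝ} (h : IsTriple s m) (hm : m ≠ 0)
    (hs : ∀ i, ε • dualMat (s i) = s i) {W : Mat4} (hW : Wᵀ = -W)
    (hWd : ε • dualMat W = W) (hp : ∀ i, pairing (s i) W = 0) : W = 0 := by
  -- A self-dual matrix is determined by its first row, and on such matrices the pairing is a
  -- multiple of the dot product of rows. The rows of the triple are therefore orthogonal and of
  -- nonzero length, so they span ℝ³.
  let row : Mat4 → Fin 3 → ℝ := fun A => ![A 0 1, A 0 2, A 0 3]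
  have hε : ∀ A B : Mat4, ε • dualMat A = A → ε • dualMat B = B →
      ε * pairing A B = 2 * (row A ⬝ᵥ row B) := fun A B hA hB => by
    have a1 : ε * A 2 3 = A 0 1 := by simpa [dualMat] using congrFun (congrFun hA 0) 1
    have a2 : -(ε * A 1 3) = A 0 2 := by simpa [dualMat] using congrFun (congrFun hA 0) 2
    have a3 : ε * A 1 2 = A 0 3 := by simpa [dualMat] using congrFun (congrFun hA 0) 3
    have b1 : ε * B 2 3 = B 0 1 := by simpa [dualMat] using congrFun (congrFun hB 0) 1
    have b2 : -(ε * B 1 3) = B 0 2 := by simpa [dualMat] using congrFun (congrFun hB 0) 2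
    have b3 : ε * B 1 2 = B 0 3 := by simpa [dualMat] using congrFun (congrFun hB 0) 3
    simp only [pairing, row, dotProduct, Fin.sum_univ_three, cons_val_zero, cons_val_one, cons_val]
    linear_combination A 0 1 * b1 + A 0 2 * b2 + A 0 3 * b3 + B 0 3 * a3 + B 0 2 * a2 + B 0 1 * a1
  have hε0 : ε ≠ 0 := by
    rintro rfl
    have h0 : s 0 = 0 := by rw [← hs 0, zero_smul]
    have h1 := h.pairing_eq 0 0
    rw [if_pos rfl, h0] at h1
    simp [pairing] at h1
    exact hm h1
  let R : Matrix (Fin 3) (Fin 3) ℝ := of fun i => row (s i)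
  have hR : R * Rᵀ = (ε * m) • (1 : Matrix (Fin 3) (Fin 3) ℝ) := by
    ext i j
    have h1 := hε _ _ (hs i) (hs j)
    rw [h.pairing_eq] at h1
    have h2 : (R * Rᵀ) i j = row (s i) ⬝ᵥ row (s j) := rfl
    rw [h2, Matrix.smul_apply, one_apply, smul_eq_mul]
    split_ifs at h1 ⊢ <;> linarith
  have hdet : R.det ≠ 0 := fun h0 => by
    have h1 := congrArg det hR
    rw [det_mul, h0, zero_mul, det_smul, det_one, mul_one] at h1
    exact pow_ne_zero _ (mul_ne_zero hε0 hm) h1.symm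
  have hrow : row W = 0 := by
    refine Matrix.eq_zero_of_mulVec_eq_zero hdet ?_
    funext i
    have h1 := hε _ _ (hs i) hWd
    rw [hp, mul_zero] at h1
    have h2 : (R *ᵥ row W) i = row (s i) ⬝ᵥ row W := rfl
    rw [h2, Pi.zero_apply]
    linarith
  have w1 : W 0 1 = 0 := congrFun hrow 0
  have w2 : W 0 2 = 0 := congrFun hrow 1
  have w3 : W 0 3 = 0 := congrFun hrow 2
  obtain ⟨a, b, c, d, e, f, rfl⟩ := exists_eq_skewMat hW
  have d1 := congrFun (congrFun hWd 2) 3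
  have d2 := congrFun (congrFun hWd 1) 3
  have d3 := congrFun (congrFun hWd 1) 2
  simp [skewMat, dualMat] at w1 w2 w3 d1 d2 d3
  subst w1 w2 w3
  simp at d1 d2 d3
  subst d1 d2 d3
  ext i j
  fin_cases i <;> fin_cases j <;> simp [skewMat]

/-! ### Bilinear functions and extension from a basis -/

/-- A function of two vectors is bilinear. -/
def IsBilin {V : Type*} [AddCommGroup V] [Module ℝ V] (f : V → V → ℝ) : Prop :=
  ∃ B : V →ₗ[ℝ] V →ₗ[ℝ] ℝ, ∀ u v, f u v = B u v

namespace IsBilin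

variable {V : Type*} [AddCommGroup V] [Module ℝ V] {f f' : V → V → ℝ}

theorem add (hf : IsBilin f) (hf' : IsBilin f') : IsBilin fun u v => f u v + f' u v := by
  obtain ⟨B, hB⟩ := hf
  obtain ⟨B', hB'⟩ := hf'
  exact ⟨B + B', fun u v => by simp [hB, hB']⟩

theorem const_mul (hf : IsBilin f) (c : ℝ) : IsBilin fun u v => c * f u v := by
  obtain ⟨B, hB⟩ := hf
  exact ⟨c • B, fun u v => by simp [hB]⟩

theorem sum {ι : Type*} {s : Finset ι} {F : ι → V → V → ℝ} (hF : ∀ i, IsBilin (F i)) :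
    IsBilin fun u v => ∑ i ∈ s, F i u v := by
  choose B hB using hF
  exact ⟨∑ i ∈ s, B i, fun u v => by simp [hB, LinearMap.sum_apply]⟩

theorem ext_basis {ι : Type*} (hf : IsBilin f) (hf' : IsBilin f') (b : Module.Basis ι ℝ V)
    (h : ∀ i j, f (b i) (b j) = f' (b i) (b j)) (u v : V) : f u v = f' u v := by
  obtain ⟨B, hB⟩ := hf
  obtain ⟨B', hB'⟩ := hf'
  have : B = B' := b.ext fun i => b.ext fun j => by rw [← hB, ← hB', h]
  rw [hB, hB', this]

end IsBilin

/-! ### Hodge star and self-dual part in an orthonormal frame -/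

section Frame

variable {V : Type*} [AddCommGroup V] [Module ℝ V] [TopologicalSpace V]

theorem isBilin_ev2 (τ : V [⋀^Fin 2]→L[ℝ] ℝ) : IsBilin (ev2 τ) :=
  ⟨LinearMap.mk₂ ℝ (ev2 τ) (fun u u' v => τ.toAlternatingMap.map_vecCons_add ![v] u u')
    (fun c u v => τ.toAlternatingMap.map_vecCons_smul ![v] c u)
    (fun u v v' => by
      rw [← interior2_apply, map_add, interior2_apply, interior2_apply])
    (fun c u v => by
      rw [← interior2_apply, map_smul, interior2_apply]), fun _ _ => rfl⟩

theorem vol_swap (vol : V [⋀^Fin 4]→L[ℝ] ℝ) (a b c d : V) :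
    vol ![b, a, c, d] = -vol ![a, b, c, d] ∧ vol ![a, c, b, d] = -vol ![a, b, c, d] ∧
      vol ![a, b, d, c] = -vol ![a, b, c, d] := by
  refine ⟨?_, ?_, ?_⟩
  · have h := vol.toAlternatingMap.map_swap ![a, b, c, d] (show (0 : Fin 4) ≠ 1 by decide)
    have h2 : ![a, b, c, d] ∘ Equiv.swap (0 : Fin 4) 1 = ![b, a, c, d] := by
      funext i; fin_cases i <;> rfl
    rw [h2] at h
    exact h
  · have h := vol.toAlternatingMap.map_swap ![a, b, c, d] (show (1 : Fin 4) ≠ 2 by decide)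
    have h2 : ![a, b, c, d] ∘ Equiv.swap (1 : Fin 4) 2 = ![a, c, b, d] := by
      funext i; fin_cases i <;> rfl
    rw [h2] at h
    exact h
  · have h := vol.toAlternatingMap.map_swap ![a, b, c, d] (show (2 : Fin 4) ≠ 3 by decide)
    have h2 : ![a, b, c, d] ∘ Equiv.swap (2 : Fin 4) 3 = ![a, b, d, c] := by
      funext i; fin_cases i <;> rfl
    rw [h2] at h
    exact h

theorem isBilin_vol (vol : V [⋀^Fin 4]→L[ℝ] ℝ) (c d : V) :
    IsBilin fun u v => vol ![u, v, c, d] := by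
  have hadd : ∀ u u' v, vol ![u + u', v, c, d] = vol ![u, v, c, d] + vol ![u', v, c, d] :=
    fun u u' v => vol.toAlternatingMap.map_vecCons_add ![v, c, d] u u'
  have hsmul : ∀ (r : ℝ) u v, vol ![r • u, v, c, d] = r • vol ![u, v, c, d] :=
    fun r u v => vol.toAlternatingMap.map_vecCons_smul ![v, c, d] r u
  refine ⟨LinearMap.mk₂ ℝ (fun u v => vol ![u, v, c, d]) hadd hsmul (fun u v v' => ?_)
    (fun r u v => ?_), fun _ _ => rfl⟩
  · rw [(vol_swap vol (v + v') u c d).1, hadd, (vol_swap vol u v c d).1, (vol_swap vol u v' c d).1,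
      neg_add, neg_neg, neg_neg]
  · rw [(vol_swap vol (r • v) u c d).1, hsmul, (vol_swap vol u v c d).1, smul_neg, neg_neg]

theorem isBilin_hodge2 (vol : V [⋀^Fin 4]→L[ℝ] ℝ) (b : Fin 4 → V) (τ : V [⋀^Fin 2]→L[ℝ] ℝ) :
    IsBilin (hodge2 vol b τ) := by
  unfold hodge2
  refine IsBilin.const_mul (IsBilin.sum fun ρ => IsBilin.sum fun η => ?_) _
  simpa only [mul_comm] using (isBilin_vol vol (b ρ) (b η)).const_mul (ev2 τ (b ρ) (b η))

theorem hodge2_frame (vol : V [⋀^Fin 4]→L[ℝ] ℝ) (b : Fin 4 → V) (τ : V [⋀^Fin 2]→L[ℝ] ℝ)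
    (i j : Fin 4) : hodge2 vol b τ (b i) (b j) = vol b * dualMat (formMat τ b) i j := by
  have h := half_sum_alternating (fun i j k l => vol ![b i, b j, b k, b l])
    (fun _ _ _ _ => (vol_swap vol _ _ _ _).1) (fun _ _ _ _ => (vol_swap vol _ _ _ _).2.1)
    (fun _ _ _ _ => (vol_swap vol _ _ _ _).2.2) (formMat_transpose τ b) i j
  have hb : (![b 0, b 1, b 2, b 3] : Fin 4 → V) = b := by
    funext i; fin_cases i <;> rfl
  simp only [hb] at h
  exact h

theorem quaternionic_frame {S : Fin 3 → V [⋀^Fin 2]→L[ℝ] ℝ} {g : V →L[ℝ] V →L[ℝ] ℝ}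
    (hq : IsQuaternionic S g) {b : Fin 4 → V} (hb : IsOrthonormalFrame g b) :
    (∀ i, formMat (S i) b * formMat (S i) b = -1) ∧
      formMat (S 0) b * formMat (S 1) b = formMat (S 2) b := by
  refine ⟨fun i => ?_, ?_⟩
  · ext x y
    have h := hq b hb i i (b x) (b y)
    rw [if_pos rfl, hb] at h
    refine h.trans ?_
    rw [neg_apply, one_apply]
    simp [eps]
  · ext x y
    have h := hq b hb 0 1 (b x) (b y)
    refine h.trans ?_
    simp [eps, Fin.sum_univ_three, formMat]
    ring

/-- Contracting with the dual of τ computes the wedge product, each index pair being counted twice.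
-/
theorem contract2_eq_pairing (b : Fin 4 → V) (τ η : V [⋀^Fin 2]→L[ℝ] ℝ) {c : ℝ}
    (h : dualMat (formMat τ b) = c • formMat τ b) :
    c * contract2 b τ η = 2 * pairing (formMat τ b) (formMat η b) := by
  have h1 := sum_dualMat_mul (formMat τ b) (formMat η b)
  rw [formMat_transpose, sub_neg_eq_add, pairing_add, h] at h1
  rw [two_mul, ← h1, contract2, Finset.mul_sum]
  refine Finset.sum_congr rfl fun i _ => ?_
  rw [Finset.mul_sum]
  refine Finset.sum_congr rfl fun j _ => ?_
  simp only [Matrix.smul_apply, smul_eq_mul, formMat, of_apply, mul_assoc]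

/-- The self-dual part of a 2-form whose wedge products with a quaternionic triple are known. -/
theorem selfDual_part {S : Fin 3 → V [⋀^Fin 2]→L[ℝ] ℝ} {g : V →L[ℝ] V →L[ℝ] ℝ}
    (hq : IsQuaternionic S g) (b : Module.Basis (Fin 4) ℝ V) (hb : IsOrthonormalFrame g b)
    {m σ : ℝ} (hm : m ≠ 0) (ht : IsTriple (fun i => formMat (S i) b) m)
    (hmσ : m • gramMat g b = σ • cubic (fun i => formMat (S i) b)) {F : V [⋀^Fin 2]→L[ℝ] ℝ}
    {θ : Fin 3 → ℝ} (hF : ∀ i, pairing (formMat (S i) b) (formMat F b) = 2 * σ * m * θ i) :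
    (∀ i, θ i = -(1 / 4) * contract2 b (S i) F) ∧
      ∀ vol, IsVolumeForm g vol → (∀ i u v, hodge2 vol b (S i) u v = ev2 (S i) u v) →
        ∀ u v, (1 / 2) * (ev2 F u v + hodge2 vol b F u v) = -∑ i, θ i * ev2 (S i) u v := by
  obtain ⟨hsq, h01⟩ := quaternionic_frame hq hb
  -- Multiply `dualMat s * s = -m • 1` on the right by `s` and use s² = -1.
  have hdual : ∀ i, dualMat (formMat (S i) b) = m • formMat (S i) b := fun i => by
    have h1 := congrArg (fun X => X * formMat (S i) b) (ht.dual_mul_self i)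
    simp only [Matrix.mul_assoc, hsq, mul_neg, Matrix.mul_one] at h1
    rw [smul_mul_assoc, Matrix.one_mul, neg_smul] at h1
    exact neg_injective h1
  have hgram : gramMat g b = 1 := by
    ext x y
    exact hb x y
  -- In this frame the cubic is m s₀s₁s₂ = m s₂² = -m, while the Gram matrix is the identity.
  have hσ : σ = -1 := by
    have h1 : cubic (fun i => formMat (S i) b) = -(m • (1 : Mat4)) := by
      rw [cubic, hdual, mul_smul_comm, h01, smul_mul_assoc, hsq, smul_neg]
    rw [h1, hgram] at hmσ
    have h2 := congrFun (congrFun hmσ 0) 0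
    simp at h2
    have h3 : m * (σ + 1) = 0 := by linarith
    linarith [(mul_eq_zero.1 h3).resolve_left hm]
  subst hσ
  refine ⟨fun i => ?_, fun vol hvol hstar => ?_⟩
  · have h1 := contract2_eq_pairing b (S i) F (hdual i)
    rw [hF] at h1
    have h2 : m * (contract2 b (S i) F + 4 * θ i) = 0 := by linarith
    linarith [(mul_eq_zero.1 h2).resolve_left hm]
  have hε : vol b ^ 2 = 1 := by rw [← sq_abs, hvol b hb, one_pow]
  have hs : ∀ i, vol b • dualMat (formMat (S i) b) = formMat (S i) b := fun i => by
    ext x y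
    rw [Matrix.smul_apply, smul_eq_mul, ← hodge2_frame]
    exact hstar i (b x) (b y)
  have hFs := formMat_transpose F b
  -- Twice the difference of the two sides of the star formula: it is self-dual and orthogonal to
  -- the triple, hence zero.
  let W : Mat4 := formMat F b + vol b • dualMat (formMat F b) + ∑ i, (2 * θ i) • formMat (S i) b
  have hW : W = 0 := by
    refine ht.eq_zero_of_pairing hm hs (W := W) ?_ ?_ fun i => ?_
    · simp only [W, Fin.sum_univ_three, transpose_add, transpose_smul, dualMat_transpose,
        formMat_transpose, smul_neg]
      abel
    · simp only [W, Fin.sum_univ_three, dualMat_add, dualMat_smul, dualMat_dualMat hFs, smul_add,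
        smul_smul, ← sq, hε, one_smul]
      simp only [mul_comm (vol b), ← smul_smul, hs]
      abel
    · have h1 : vol b * pairing (formMat (S i) b) (dualMat (formMat F b)) =
          pairing (formMat (S i) b) (formMat F b) := by
        conv_lhs => rw [← hs i, pairing_comm, pairing_smul, pairing_dualMat, pairing_comm]
        rw [← mul_assoc, ← sq, hε, one_mul]
      have h2 := ht.pairing_eq i
      simp only [W, Fin.sum_univ_three, pairing_add, pairing_smul, h1, hF] at h2 ⊢
      rw [h2, h2, h2]
      fin_cases i <;> simp <;> ring
  refine IsBilin.ext_basis (((isBilin_ev2 F).add (isBilin_hodge2 vol b F)).const_mul _)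
    (f' := fun u v => -∑ i, θ i * ev2 (S i) u v) ?_ b fun x y => ?_
  · simpa only [neg_one_mul] using
      (IsBilin.sum (s := Finset.univ) fun i => (isBilin_ev2 (S i)).const_mul (θ i)).const_mul (-1)
  · have h1 := congrFun (congrFun hW x) y
    simp only [W, Matrix.add_apply, Matrix.sum_apply, Matrix.smul_apply, smul_eq_mul,
      Matrix.zero_apply, ← hodge2_frame, mul_assoc, ← Finset.mul_sum] at h1
    simp only [formMat, of_apply] at h1
    linarith

end Frame

/-! ### Calculus of matrices -/

open Filter Topology

/-- Entrywise derivative at `0` of a curve of matrices. -/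
def HasEntryDeriv (A : ℝ → Mat4) (A' : Mat4) : Prop :=
  ∀ a b, HasDerivAt (fun t => A t a b) (A' a b) 0

namespace HasEntryDeriv

variable {A B : ℝ → Mat4} {A' B' : Mat4}

theorem mul (hA : HasEntryDeriv A A') (hB : HasEntryDeriv B B') :
    HasEntryDeriv (fun t => A t * B t) (A' * B 0 + A 0 * B') := fun a b => by
  have h := HasDerivAt.fun_sum (u := Finset.univ) fun c _ => (hA a c).fun_mul (hB c b)
  simpa only [Matrix.mul_apply, Matrix.add_apply, ← Finset.sum_add_distrib] using h

theorem dualMat (hA : HasEntryDeriv A A') :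
    HasEntryDeriv (fun t => dualMat (A t)) (SigmaKilling.dualMat A') := fun a b => by
  fin_cases a <;> fin_cases b <;> simp [SigmaKilling.dualMat] <;>
    first
    | exact hasDerivAt_const _ _
    | exact hA _ _
    | exact (hA _ _).fun_neg

theorem cubic {s : ℝ → Fin 3 → Mat4} {r : Fin 3 → Mat4}
    (hs : ∀ i, HasEntryDeriv (fun t => s t i) (r i)) :
    HasEntryDeriv (fun t => cubic (s t)) (r 0 * SigmaKilling.dualMat (s 0 1) * s 0 2 +
      s 0 0 * SigmaKilling.dualMat (r 1) * s 0 2 + s 0 0 * SigmaKilling.dualMat (s 0 1) * r 2) := by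
  have h := ((hs 0).mul (hs 1).dualMat).mul (hs 2)
  rwa [add_mul] at h

theorem pairing_half (hA : HasEntryDeriv A A') :
    HasDerivAt (fun t => pairing (A t) (A t) / 2) (pairing (A 0) A') 0 := by
  have h := (((((((hA 0 1).mul (hA 2 3)).sub ((hA 0 2).mul (hA 1 3))).add
    ((hA 0 3).mul (hA 1 2))).add ((hA 1 2).mul (hA 0 3))).sub ((hA 1 3).mul (hA 0 2))).add
    ((hA 2 3).mul (hA 0 1))).div_const 2
  refine h.congr_deriv ?_
  simp only [pairing]
  ring

end HasEntryDeriv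

/-- The matrix of directional derivatives of the entries. -/
def dirDeriv (A : E4 → Mat4) (y : E4) (w : E4) : Mat4 :=
  of fun a b => fderiv ℝ (fun z => A z a b) y w

theorem hasEntryDeriv_line {A : E4 → Mat4} {y : E4}
    (hA : ∀ a b, DifferentiableAt ℝ (fun z => A z a b) y) (w : E4) :
    HasEntryDeriv (fun t => A (y + t • w)) (dirDeriv A y w) := fun a b =>
  (hA a b).hasFDerivAt.hasLineDerivAt w

/-! ### The metric as a function of the triple near a point -/

/-- Near `y`, the matrices `s` of a triple and the Gram matrix `G` of a metric satisfy
`m G = σ cubic s` with a locally constant sign `σ`. -/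
structure IsLocalMetric (s : E4 → Fin 3 → Mat4) (G : E4 → Mat4) (y : E4) (σ : ℝ) : Prop where
  sq : σ ^ 2 = 1
  differentiable : ∀ i a b, DifferentiableAt ℝ (fun z => s z i a b) y
  eventually : ∀ᶠ z in 𝓝 y, ∃ m, m ≠ 0 ∧ IsTriple (s z) m ∧ m • G z = σ • cubic (s z)

theorem differentiableAt_cubic {s : E4 → Fin 3 → Mat4} {y : E4}
    (hs : ∀ i a b, DifferentiableAt ℝ (fun z => s z i a b) y) (a b : Fin 4) :
    DifferentiableAt ℝ (fun z => cubic (s z) a b) y := by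
  have hd : ∀ c d, DifferentiableAt ℝ (fun z => dualMat (s z 1) c d) y := fun c d => by
    fin_cases c <;> fin_cases d <;> simp [dualMat] <;> exact hs _ _ _
  simp only [cubic, Matrix.mul_apply, Finset.sum_mul]
  exact DifferentiableAt.fun_sum fun c _ => DifferentiableAt.fun_sum fun d _ =>
    ((hs 0 a d).mul (hd d c)).mul (hs 2 c b)

theorem differentiableAt_pairing_half {s : E4 → Fin 3 → Mat4} {y : E4}
    (hs : ∀ i a b, DifferentiableAt ℝ (fun z => s z i a b) y) :
    DifferentiableAt ℝ (fun z => pairing (s z 0) (s z 0) / 2) y := by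
  have h := hs 0
  simp only [pairing]
  fun_prop

theorem IsTriple.eq_pairing_half {s : Fin 3 → Mat4} {m : ℝ} (h : IsTriple s m) :
    m = pairing (s 0) (s 0) / 2 := by
  rw [h.pairing_eq, if_pos rfl]
  ring

/-- The quotient of the (0,0) entry of the cubic by the Pfaffian is continuous and equals σ G₀₀ with
G₀₀ > 0. Its sign, hence σ, cannot jump. -/
theorem exists_isLocalMetric {s : E4 → Fin 3 → Mat4} {G : E4 → Mat4} {y : E4}
    (hs : ∀ i a b, DifferentiableAt ℝ (fun z => s z i a b) y)
    (h : ∀ᶠ z in 𝓝 y, 0 < G z 0 0 ∧ ∃ m σ : ℝ, m ≠ 0 ∧ σ ^ 2 = 1 ∧ IsTriple (s z) m ∧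
      m • G z = σ • cubic (s z)) : ∃ σ, IsLocalMetric s G y σ := by
  obtain ⟨hG, m, σ, hm, hσ, ht, hmG⟩ := h.self_of_nhds
  have hcont : ContinuousAt (fun z => cubic (s z) 0 0 / (pairing (s z 0) (s z 0) / 2)) y :=
    (differentiableAt_cubic hs 0 0).continuousAt.div
      (differentiableAt_pairing_half hs).continuousAt (by rw [← ht.eq_pairing_half]; exact hm)
  have key : ∀ {z : E4} {m σ : ℝ}, m ≠ 0 → σ ^ 2 = 1 → IsTriple (s z) m →
      m • G z = σ • cubic (s z) →
      cubic (s z) 0 0 / (pairing (s z 0) (s z 0) / 2) = σ * G z 0 0 := by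
    intro z m σ hm hσ ht hmG
    have h1 : m * G z 0 0 = σ * cubic (s z) 0 0 := congrFun (congrFun hmG 0) 0
    rw [← ht.eq_pairing_half, div_eq_iff hm]
    linear_combination -cubic (s z) 0 0 * hσ - σ * h1
  have hpos : ∀ᶠ z in 𝓝 y, 0 < σ * (cubic (s z) 0 0 / (pairing (s z 0) (s z 0) / 2)) := by
    refine (continuousAt_const.mul hcont).eventually (lt_mem_nhds ?_)
    change 0 < σ * (cubic (s y) 0 0 / (pairing (s y 0) (s y 0) / 2))
    rw [key hm hσ ht hmG, ← mul_assoc, ← sq, hσ, one_mul]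
    exact hG
  refine ⟨σ, hσ, hs, ?_⟩
  filter_upwards [h, hpos] with z ⟨hGz, m', σ', hm', hσ', ht', hmG'⟩ hz
  rw [key hm' hσ' ht' hmG', ← mul_assoc] at hz
  have h1 : 0 < σ * σ' := pos_of_mul_pos_left hz hGz.le
  have h2 : σ' = σ := by
    rcases eq_or_eq_neg_of_sq_eq_sq σ 1 (by rw [hσ, one_pow]) with rfl | rfl <;>
      rcases eq_or_eq_neg_of_sq_eq_sq σ' 1 (by rw [hσ', one_pow]) with rfl | rfl <;>
      first | rfl | norm_num at h1
  exact ⟨m', hm', ht', by rw [hmG', h2]⟩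

namespace IsLocalMetric

variable {s : E4 → Fin 3 → Mat4} {G : E4 → Mat4} {y : E4} {σ : ℝ}

/-- Differentiability is inherited from the triple through G = σ cubic / m. -/
theorem differentiableAt_metric (h : IsLocalMetric s G y σ) (a b : Fin 4) :
    DifferentiableAt ℝ (fun z => G z a b) y := by
  obtain ⟨m, hm, ht, -⟩ := h.eventually.self_of_nhds
  have hd : DifferentiableAt ℝ
      (fun z => σ * cubic (s z) a b * (pairing (s z 0) (s z 0) / 2)⁻¹) y :=
    ((differentiableAt_cubic h.differentiable a b).const_mul σ).fun_mul
      ((differentiableAt_pairing_half h.differentiable).fun_inv (ht.eq_pairing_half ▸ hm))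
  refine hd.congr_of_eventuallyEq ?_
  filter_upwards [h.eventually] with z ⟨m, hm, ht, hmG⟩
  have h1 : m * G z a b = σ * cubic (s z) a b := congrFun (congrFun hmG a) b
  rw [← ht.eq_pairing_half, ← h1, ← div_eq_mul_inv, mul_div_cancel_left₀ _ hm]

/-- If the Lie derivatives of the triple are infinitesimal rotations, the Lie derivative of the
metric vanishes. -/
theorem dirDeriv_metric (h : IsLocalMetric s G y σ) (w : E4) (B : Mat4) (t : Fin 3 → ℝ)
    (hr : ∀ i, dirDeriv (fun z => s z i) y w =
      -(Bᵀ * s y i + s y i * B) + (t (i + 1) • s y (i + 2) - t (i + 2) • s y (i + 1))) :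
    dirDeriv G y w = -(Bᵀ * G y + G y * B) := by
  obtain ⟨m, hm, ht, hmG⟩ := h.eventually.self_of_nhds
  have hs : ∀ i, HasEntryDeriv (fun τ => s (y + τ • w) i) (dirDeriv (fun z => s z i) y w) :=
    fun i => hasEntryDeriv_line (h.differentiable i) w
  have hG := hasEntryDeriv_line h.differentiableAt_metric w
  have hc := HasEntryDeriv.cubic (s := fun τ => s (y + τ • w)) hs
  have hp := (hs 0).pairing_half
  have hline : Tendsto (fun τ : ℝ => y + τ • w) (𝓝 0) (𝓝 y) := by
    have hcont : Continuous fun τ : ℝ => y + τ • w := by fun_prop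
    simpa using hcont.tendsto 0
  simp only [zero_smul, add_zero] at hc hp
  rw [ht.cubic_variation B t _ hr] at hc
  rw [ht.pairing_variation B t _ hr] at hp
  have hmat : m • dirDeriv G y w = -(m • (Bᵀ * G y + G y * B)) := by
    have h1 : m • (Bᵀ * G y + G y * B) = σ • (Bᵀ * cubic (s y) + cubic (s y) * B) := by
      rw [smul_add, ← mul_smul_comm, ← smul_mul_assoc, hmG, mul_smul_comm, smul_mul_assoc,
        smul_add]
    rw [h1]
    ext a b
    have e1 := hp.mul (hG a b)
    have e2 := (hc a b).const_mul σ
    have e3 : (fun τ : ℝ => pairing (s (y + τ • w) 0) (s (y + τ • w) 0) / 2 * G (y + τ • w) a b)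
        =ᶠ[𝓝 0] fun τ => σ * cubic (s (y + τ • w)) a b := by
      filter_upwards [hline.eventually h.eventually] with τ ⟨m', _, ht', hmG'⟩
      rw [← ht'.eq_pairing_half]
      exact congrFun (congrFun hmG' a) b
    have e4 := e1.unique (e2.congr_of_eventuallyEq e3)
    have e5 : m * G y a b = σ * cubic (s y) a b := congrFun (congrFun hmG a) b
    simp only [zero_smul, add_zero] at e4
    rw [← ht.eq_pairing_half] at e4
    simp only [Matrix.smul_apply, Matrix.sub_apply, Matrix.neg_apply, Matrix.add_apply,
      smul_eq_mul] at e4 ⊢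
    -- The trace terms from the Pfaffian and from the cubic agree because m G = σ cubic.
    linear_combination e4 + B.trace * e5
  rw [← smul_neg] at hmat
  exact smul_right_injective _ hm hmat

/-- Matrix form of Σ^i ∧ X^♭ = σ Σ^{i+1} ∧ ι_X Σ^{i+2}. It holds on a neighbourhood, so it may be
differentiated. -/
theorem dualMat_mulVec (h : IsLocalMetric s G y σ) (Y : E4 → Fin 4 → ℝ) (i : Fin 3) :
    ∀ᶠ z in 𝓝 y, dualMat (s z i) *ᵥ (G z *ᵥ Y z) =
      σ • (dualMat (s z (i + 1)) *ᵥ -(s z (i + 2) *ᵥ Y z)) := by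
  filter_upwards [h.eventually] with z ⟨m, hm, ht, hmG⟩
  have h1 : m • (dualMat (s z i) * G z) = m • (σ • -(dualMat (s z (i + 1)) * s z (i + 2))) := by
    rw [← mul_smul_comm, hmG, mul_smul_comm, ht.dual_mul_cubic, smul_comm σ, neg_smul, smul_neg,
      smul_neg]
  rw [mulVec_mulVec, smul_right_injective _ hm h1, mulVec_neg, mulVec_mulVec, smul_mulVec,
    neg_mulVec]

/-- The divergence of the identity relating `Σ^i ∧ X^♭` and `Σ^{i+1} ∧ ι_X Σ^{i+2}`. -/
theorem divergence (h : IsLocalMetric s G y σ) (f : Fin 4 → E4) (α : E4 → Fin 4 → ℝ)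
    (β : E4 → Fin 3 → Fin 4 → ℝ) (hα : ∀ b, DifferentiableAt ℝ (fun z => α z b) y)
    (hβ : ∀ i b, DifferentiableAt ℝ (fun z => β z i b) y) (i : Fin 3)
    (hαβ : ∀ᶠ z in 𝓝 y, dualMat (s z i) *ᵥ α z = σ • (dualMat (s z (i + 1)) *ᵥ β z (i + 2))) :
    ∑ c, ∑ b, (dualMat (dirDeriv (fun z => s z i) y (f c)) c b * α y b +
        dualMat (s y i) c b * fderiv ℝ (fun z => α z b) y (f c)) =
      σ * ∑ c, ∑ b, (dualMat (dirDeriv (fun z => s z (i + 1)) y (f c)) c b * β y (i + 2) b +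
        dualMat (s y (i + 1)) c b * fderiv ℝ (fun z => β z (i + 2) b) y (f c)) := by
  rw [Finset.mul_sum]
  refine Finset.sum_congr rfl fun c _ => ?_
  have hline : Tendsto (fun τ : ℝ => y + τ • f c) (𝓝 0) (𝓝 y) := by
    have hcont : Continuous fun τ : ℝ => y + τ • f c := by fun_prop
    simpa using hcont.tendsto 0
  have hs : ∀ i, HasEntryDeriv (fun τ => dualMat (s (y + τ • f c) i))
      (dualMat (dirDeriv (fun z => s z i) y (f c))) :=
    fun i => (hasEntryDeriv_line (h.differentiable i) (f c)).dualMat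
  have e1 := HasDerivAt.fun_sum (u := Finset.univ) fun b _ =>
    (hs i c b).mul ((hα b).hasFDerivAt.hasLineDerivAt (f c))
  have e2 := (HasDerivAt.fun_sum (u := Finset.univ) fun b _ =>
    (hs (i + 1) c b).mul ((hβ (i + 2) b).hasFDerivAt.hasLineDerivAt (f c))).const_mul σ
  have e3 := e1.unique (e2.congr_of_eventuallyEq ?_)
  · simpa only [zero_smul, add_zero] using e3
  · filter_upwards [hline.eventually hαβ] with τ hτ
    exact congrFun hτ c

end IsLocalMetric

/-! ### Charts -/

section Chart

variable {M : Type*} [TopologicalSpace M] [ChartedSpace E4 M]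

theorem extChartAt_target_mem_nhds_base (p : M) :
    (extChartAt (𝓡 4) p).target ∈ 𝓝 (extChartAt (𝓡 4) p p) :=
  extChartAt_target_mem_nhds p

theorem ev2_formInChart (τ : Form M 2) (p : M) (z u v : E4) :
    ev2 (formInChart p τ z) u v =
      ev2 (τ ((extChartAt (𝓡 4) p).symm z)) (chartSymmDeriv p z u) (chartSymmDeriv p z v) := by
  unfold ev2 formInChart
  rw [ContinuousAlternatingMap.compContinuousLinearMap_apply]
  congr 1
  funext i
  fin_cases i <;> rfl

variable [IsManifold (𝓡 4) ∞ M]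

/-- The tangent space at `p` is modelled on E4 through this very chart. -/
theorem chartDeriv_apply (p : M) (v : TangentSpace (𝓡 4) p) : chartDeriv p v = v := by
  unfold chartDeriv
  rw [mfderiv_extChartAt_self]
  rfl

theorem chartSymmDeriv_base (p : M) :
    (chartSymmDeriv p (extChartAt (𝓡 4) p p) : E4 →L[ℝ] E4) = ContinuousLinearMap.id ℝ E4 := by
  have h := mfderivWithin_range_extChartAt_symm (I := 𝓡 4) (x := p)
  rw [ModelWithCorners.range_eq_univ, mfderivWithin_univ] at h
  exact h

theorem isInvertible_chartSymmDeriv {p : M} {z : E4} (hz : z ∈ (extChartAt (𝓡 4) p).target) :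
    (chartSymmDeriv p z).IsInvertible := by
  have h := isInvertible_mfderivWithin_extChartAt_symm (I := 𝓡 4) hz
  rw [ModelWithCorners.range_eq_univ, mfderivWithin_univ] at h
  exact h

theorem formInChart_base {k : ℕ} (τ : Form M k) (p : M) (v : Fin k → E4) :
    formInChart p τ (extChartAt (𝓡 4) p p) v = τ p v := by
  -- The base point is generalised because the type of the form depends on it.
  have aux : ∀ (q : M) (_ : q = p) (L : E4 →L[ℝ] E4), L = ContinuousLinearMap.id ℝ E4 →
      (τ q) (fun i => L (v i)) = τ p v := by
    rintro q rfl L rfl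
    rfl
  exact aux _ (extChartAt_to_inv p) _ (chartSymmDeriv_base p)

theorem tensorInChart_base (T : Tensor2 M) (p : M) (u v : E4) :
    tensorInChart p T (extChartAt (𝓡 4) p p) u v = T p u v := by
  have aux : ∀ (q : M) (_ : q = p) (L : E4 →L[ℝ] E4), L = ContinuousLinearMap.id ℝ E4 →
      T q (L u) (L v) = T p u v := by
    rintro q rfl L rfl
    rfl
  exact aux _ (extChartAt_to_inv p) _ (chartSymmDeriv_base p)

theorem chartSymmDeriv_fieldInChart (X : VField M) {p : M} {z : E4}
    (hz : z ∈ (extChartAt (𝓡 4) p).target) :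
    chartSymmDeriv p z (fieldInChart p X z) = X ((extChartAt (𝓡 4) p).symm z) :=
  (isInvertible_chartSymmDeriv hz).self_apply_inverse _

theorem fieldInChart_base (X : VField M) (p : M) :
    fieldInChart p X (extChartAt (𝓡 4) p p) = X p := by
  have aux : ∀ (q : M) (_ : q = p) (L : E4 →L[ℝ] E4), L = ContinuousLinearMap.id ℝ E4 →
      L.inverse (X q) = X p := by
    rintro q rfl L rfl
    rw [ContinuousLinearMap.inverse_id]
    rfl
  exact aux _ (extChartAt_to_inv p) _ (chartSymmDeriv_base p)

theorem differentiableAt_fieldInChart {X : VField M} (hX : IsSmoothField X) (p : M) :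
    DifferentiableAt ℝ (fieldInChart p X) (extChartAt (𝓡 4) p p) := by
  have hX1 : ContMDiffWithinAt (𝓡 4) (𝓡 4).tangent 1
      (fun p => (⟨p, X p⟩ : TangentBundle (𝓡 4) M)) Set.univ p :=
    ((hX p).of_le ENat.LEInfty.out).contMDiffWithinAt
  -- Pulling back differentiates the chart once, so a C¹ result needs a C² structure.
  have h := VectorField.contMDiffWithinAt_mpullbackWithin_extChartAt_symm (n := 2) hX1
    uniqueMDiffOn_univ (Set.mem_univ p) one_add_one_eq_two.le
  rw [ModelWithCorners.range_eq_univ, VectorField.mpullbackWithin_univ, Set.preimage_univ,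
    Set.inter_univ] at h
  have h3 := h.contMDiffAt (extChartAt_target_mem_nhds_base p)
  rw [contMDiffAt_vectorSpace_iff_contDiffAt] at h3
  exact h3.differentiableAt one_ne_zero

end Chart

/-! ### Components in the preferred chart -/

section Components

variable {M : Type*} [TopologicalSpace M] [ChartedSpace E4 M]

/-- The matrices of a triple of 2-forms in the preferred chart at `p`. -/
def chartMat (S : Fin 3 → Form M 2) (p : M) (f : Fin 4 → E4) (z : E4) (i : Fin 3) : Mat4 :=
  formMat (formInChart p (S i) z) f

theorem differentiableAt_formInChart {k : ℕ} {τ : Form M k} (hτ : IsSmoothForm τ) (p : M) :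
    DifferentiableAt ℝ (formInChart p τ) (extChartAt (𝓡 4) p p) :=
  ((hτ p).contDiffAt (extChartAt_target_mem_nhds_base p)).differentiableAt (by simp)

theorem differentiableAt_chartMat {S : Fin 3 → Form M 2} (hS : IsSU2Structure S) (p : M)
    (f : Fin 4 → E4) (i : Fin 3) (a b : Fin 4) :
    DifferentiableAt ℝ (fun z => chartMat S p f z i a b) (extChartAt (𝓡 4) p p) :=
  (differentiableAt_formInChart (hS.smooth i) p).continuousAlternatingMap_apply_const ![f a, f b]

/-- The component of a covector field along `v` in the preferred chart at `p`. -/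
def covectorInChart (β : CovectorField M) (p : M) (v z : E4) : ℝ :=
  β ((extChartAt (𝓡 4) p).symm z) (chartSymmDeriv p z v)

theorem differentiableAt_toForm {β : CovectorField M} {p : M} (f : Module.Basis (Fin 4) ℝ E4)
    (hβ : ∀ b, DifferentiableAt ℝ (covectorInChart β p (f b)) (extChartAt (𝓡 4) p p)) :
    DifferentiableAt ℝ (formInChart p β.toForm) (extChartAt (𝓡 4) p p) := by
  have h : formInChart p β.toForm = fun z => ∑ c, covectorInChart β p (f c) z •
      ContinuousAlternatingMap.ofSubsingleton ℝ E4 ℝ (0 : Fin 1)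
        (LinearMap.toContinuousLinearMap (f.coord c)) := by
    funext z
    ext v
    have h1 : formInChart p β.toForm z v = covectorInChart β p (v 0) z := rfl
    have h2 : covectorInChart β p (v 0) z =
        ∑ c, f.repr (v 0) c * covectorInChart β p (f c) z := by
      conv_lhs => rw [← f.sum_repr (v 0)]
      simp only [covectorInChart, map_sum, map_smul, smul_eq_mul]
    rw [h1, h2]
    simp [mul_comm]
  rw [h]
  exact DifferentiableAt.fun_sum fun c _ => (hβ c).smul_const _

/-- The components of a vector field in the preferred chart at `p`. -/
def fieldComp (X : VField M) (p : M) (f : Module.Basis (Fin 4) ℝ E4) (z : E4) : Fin 4 → ℝ :=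
  fun c => f.repr (fieldInChart p X z) c

theorem sum_fieldComp (X : VField M) (p : M) (f : Module.Basis (Fin 4) ℝ E4) (z : E4) :
    fieldInChart p X z = ∑ c, fieldComp X p f z c • f c :=
  (f.sum_repr _).symm

/-- The matrix of a covariant 2-tensor field in the preferred chart at `p`. -/
def tensorMat (T : Tensor2 M) (p : M) (f : Fin 4 → E4) (z : E4) : Mat4 :=
  of fun a b => tensorInChart p T z (f a) (f b)

theorem tensorMat_ev2 (S : Fin 3 → Form M 2) (p : M) (f : Fin 4 → E4) (i : Fin 3) :
    tensorMat (fun q => ev2 (S i q)) p f = fun z => chartMat S p f z i := by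
  funext z
  ext a b
  exact (ev2_formInChart (S i) p z (f a) (f b)).symm

variable [IsManifold (𝓡 4) ∞ M]

/-- The Gram matrix of a metric in the preferred chart at `p`. -/
def chartGram (g : Metric M) (p : M) (f : Fin 4 → E4) (z : E4) : Mat4 :=
  of fun a b => tensorInChart p (fun q u v => g.inner q u v) z (f a) (f b)

/-- The derivative of the inverse chart carries `f` to a basis of each nearby tangent space, where
the pointwise algebra applies. -/
theorem exists_isLocalMetric_chart {S : Fin 3 → Form M 2} (hS : IsSU2Structure S) (g : Metric M)
    (hg : ∀ p, IsMetricOf (fun i => S i p) (g.inner p)) (p : M) (f : Module.Basis (Fin 4) ℝ E4) :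
    ∃ σ, IsLocalMetric (chartMat S p f) (chartGram g p f) (extChartAt (𝓡 4) p p) σ := by
  refine exists_isLocalMetric (differentiableAt_chartMat hS p f) ?_
  filter_upwards [extChartAt_target_mem_nhds_base p] with z hz
  obtain ⟨L, hL⟩ := isInvertible_chartSymmDeriv hz
  let e := f.map L.toLinearEquiv
  have he : ∀ a, e a = chartSymmDeriv p z (f a) := fun a => by
    rw [← hL]
    exact f.map_apply L.toLinearEquiv a
  have h1 : chartMat S p f z = fun i => formMat (S i ((extChartAt (𝓡 4) p).symm z)) e := by
    funext i
    ext a b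
    simp only [chartMat, formMat, of_apply, ev2_formInChart, he]
  have h2 : chartGram g p f z = gramMat (g.inner ((extChartAt (𝓡 4) p).symm z)) e := by
    ext a b
    simp only [chartGram, gramMat, of_apply, tensorInChart, he]
  rw [h1, h2]
  exact ⟨g.pos _ _ (e.ne_zero 0), exists_metric_eq_cubic (hS.triple _) (hg _) (g.symm _)
    (g.pos _) e⟩

theorem extD_two {τ : Form M 2} (hτ : IsSmoothForm τ) (p : M) (u v w : TangentSpace (𝓡 4) p) :
    extD τ p ![u, v, w] =
      fderiv ℝ (fun z => ev2 (formInChart p τ z) v w) (extChartAt (𝓡 4) p p) u -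
      fderiv ℝ (fun z => ev2 (formInChart p τ z) u w) (extChartAt (𝓡 4) p p) v +
      fderiv ℝ (fun z => ev2 (formInChart p τ z) u v) (extChartAt (𝓡 4) p p) w := by
  have h0 : (fun i => chartDeriv p (![u, v, w] i)) = (![u, v, w] : Fin 3 → E4) := by
    funext i
    exact chartDeriv_apply p _
  have h : extD τ p ![u, v, w] = extDeriv (formInChart p τ) (extChartAt (𝓡 4) p p)
      (![u, v, w] : Fin 3 → E4) := by
    rw [← h0]; rfl
  have r0 : (0 : Fin 3).removeNth (![u, v, w] : Fin 3 → E4) = ![v, w] := by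
    funext i; fin_cases i <;> rfl
  have r1 : (1 : Fin 3).removeNth (![u, v, w] : Fin 3 → E4) = ![u, w] := by
    funext i; fin_cases i <;> rfl
  have r2 : (2 : Fin 3).removeNth (![u, v, w] : Fin 3 → E4) = ![u, v] := by
    funext i; fin_cases i <;> rfl
  rw [h, extDeriv_apply (differentiableAt_formInChart hτ p), Fin.sum_univ_three, r0, r1, r2]
  simp only [Fin.val_zero, Fin.val_one, Fin.val_two, pow_zero, pow_one, one_smul, neg_smul]
  norm_num
  rfl

theorem extD_toForm {β : CovectorField M} {p : M} (f : Module.Basis (Fin 4) ℝ E4)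
    (hβ : ∀ b, DifferentiableAt ℝ (covectorInChart β p (f b)) (extChartAt (𝓡 4) p p))
    (u v : TangentSpace (𝓡 4) p) :
    ev2 (extD β.toForm p) u v =
      fderiv ℝ (covectorInChart β p v) (extChartAt (𝓡 4) p p) u -
      fderiv ℝ (covectorInChart β p u) (extChartAt (𝓡 4) p p) v := by
  have h0 : (fun i => chartDeriv p (![u, v] i)) = (![u, v] : Fin 2 → E4) := by
    funext i
    exact chartDeriv_apply p _
  have h : ev2 (extD β.toForm p) u v = extDeriv (formInChart p β.toForm) (extChartAt (𝓡 4) p p)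
      (![u, v] : Fin 2 → E4) := by
    rw [← h0]; rfl
  have r0 : (0 : Fin 2).removeNth (![u, v] : Fin 2 → E4) = ![v] := by
    funext i; fin_cases i; rfl
  have r1 : (1 : Fin 2).removeNth (![u, v] : Fin 2 → E4) = ![u] := by
    funext i; fin_cases i; rfl
  rw [h, extDeriv_apply (differentiableAt_toForm f hβ), Fin.sum_univ_two, r0, r1]
  simp only [Fin.val_zero, Fin.val_one, pow_zero, pow_one, one_smul, neg_smul]
  rw [← sub_eq_add_neg]
  rfl

/-- The matrix of partial derivatives of the components of a vector field. -/
def fieldJac (X : VField M) (p : M) (f : Module.Basis (Fin 4) ℝ E4) : Mat4 :=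
  of fun c a => f.repr (fderiv ℝ (fieldInChart p X) (extChartAt (𝓡 4) p p) (f a)) c

theorem hasFDerivAt_fieldComp {X : VField M} (hX : IsSmoothField X) (p : M)
    (f : Module.Basis (Fin 4) ℝ E4) (c : Fin 4) :
    HasFDerivAt (fun z => fieldComp X p f z c)
      ((LinearMap.toContinuousLinearMap (f.coord c)).comp
        (fderiv ℝ (fieldInChart p X) (extChartAt (𝓡 4) p p))) (extChartAt (𝓡 4) p p) :=
  (LinearMap.toContinuousLinearMap (f.coord c)).hasFDerivAt.comp _
    (differentiableAt_fieldInChart hX p).hasFDerivAt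

theorem fderiv_fieldComp {X : VField M} (hX : IsSmoothField X) (p : M)
    (f : Module.Basis (Fin 4) ℝ E4) (c a : Fin 4) :
    fderiv ℝ (fun z => fieldComp X p f z c) (extChartAt (𝓡 4) p p) (f a) =
      fieldJac X p f c a := by
  rw [(hasFDerivAt_fieldComp hX p f c).fderiv]
  rfl

theorem covectorInChart_interior2 (S : Fin 3 → Form M 2) (X : VField M) (p : M)
    (f : Module.Basis (Fin 4) ℝ E4) (i : Fin 3) (b : Fin 4) {z : E4}
    (hz : z ∈ (extChartAt (𝓡 4) p).target) :
    covectorInChart (fun q => interior2 (X q) (S i q)) p (f b) z =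
      ∑ c, fieldComp X p f z c * chartMat S p f z i c b := by
  obtain ⟨B, hB⟩ := isBilin_ev2 (formInChart p (S i) z)
  have h : covectorInChart (fun q => interior2 (X q) (S i q)) p (f b) z =
      B (fieldInChart p X z) (f b) := by
    rw [← hB, ev2_formInChart, chartSymmDeriv_fieldInChart X hz]
    exact interior2_apply _ _ _
  rw [h, sum_fieldComp X p f z]
  simp only [map_sum, map_smul, LinearMap.sum_apply, LinearMap.smul_apply, smul_eq_mul, ← hB]
  rfl

theorem covectorInChart_flat (g : Metric M) (X : VField M) (p : M)
    (f : Module.Basis (Fin 4) ℝ E4) (b : Fin 4) {z : E4}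
    (hz : z ∈ (extChartAt (𝓡 4) p).target) :
    covectorInChart (flat g X) p (f b) z = (chartGram g p f z *ᵥ fieldComp X p f z) b := by
  have h : covectorInChart (flat g X) p (f b) z =
      g.inner ((extChartAt (𝓡 4) p).symm z) (chartSymmDeriv p z (f b))
        (chartSymmDeriv p z (fieldInChart p X z)) := by
    rw [chartSymmDeriv_fieldInChart X hz]
    exact g.symm _ _ _
  rw [h, sum_fieldComp X p f z]
  simp only [map_sum, map_smul, smul_eq_mul, mulVec, dotProduct]
  exact Finset.sum_congr rfl fun c _ => mul_comm _ _

end Components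

/-! ### Vector fields rotating the triple -/

section Killing

theorem IsBilin.expand {V : Type*} [AddCommGroup V] [Module ℝ V] {F : V → V → ℝ}
    (hF : IsBilin F) (f : Module.Basis (Fin 4) ℝ V) (u v : V) :
    F u v = ∑ a, ∑ b, f.repr u a * f.repr v b * F (f a) (f b) := by
  obtain ⟨B, hB⟩ := hF
  conv_lhs => rw [hB, ← f.sum_repr u, ← f.sum_repr v]
  simp only [map_sum, map_smul, LinearMap.sum_apply, LinearMap.smul_apply, smul_eq_mul, ← hB,
    Finset.mul_sum, mul_assoc]
  rw [Finset.sum_comm]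
  exact Finset.sum_congr rfl fun _ _ => Finset.sum_congr rfl fun _ _ => by ring

theorem isBilin_wedge11 {V : Type*} [AddCommGroup V] [Module ℝ V] (α β : V →ₗ[ℝ] ℝ) :
    IsBilin (wedge11 α β) :=
  ⟨(LinearMap.mk₂ ℝ (fun u v => α u * β v - α v * β u)
    (fun _ _ _ => by simp only [map_add]; ring)
    (fun _ _ _ => by simp only [map_smul, smul_eq_mul]; ring)
    (fun _ _ _ => by simp only [map_add]; ring)
    (fun _ _ _ => by simp only [map_smul, smul_eq_mul]; ring)), fun _ _ => rfl⟩

theorem isBilin_comp {V W : Type*} [AddCommGroup V] [Module ℝ V] [TopologicalSpace V]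
    [AddCommGroup W] [Module ℝ W] [TopologicalSpace W] (g : W →L[ℝ] W →L[ℝ] ℝ) (L : V →L[ℝ] W) :
    IsBilin fun u v => g (L u) (L v) :=
  ⟨LinearMap.mk₂ ℝ (fun u v => g (L u) (L v)) (fun _ _ _ => by simp) (fun _ _ _ => by simp)
    (fun _ _ _ => by simp) (fun _ _ _ => by simp), fun _ _ => rfl⟩

variable {M : Type*} [TopologicalSpace M] [ChartedSpace E4 M] [IsManifold (𝓡 4) ∞ M]

/-- Matrix form ∂_X T + JᵀT + TJ of the Lie derivative, with J the Jacobian of X; it serves both the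
triple and the metric. -/
theorem lieD_eq_sum (X : VField M) (T : Tensor2 M) (p : M) (f : Module.Basis (Fin 4) ℝ E4)
    (hT : ∀ z, IsBilin (tensorInChart p T z))
    (hd : ∀ a b, DifferentiableAt ℝ (fun z => tensorMat T p f z a b) (extChartAt (𝓡 4) p p))
    (u v : E4) :
    lieD X T p u v = ∑ a, ∑ b, f.repr u a * f.repr v b *
      (dirDeriv (tensorMat T p f) (extChartAt (𝓡 4) p p)
          (fieldInChart p X (extChartAt (𝓡 4) p p)) +
        ((fieldJac X p f)ᵀ * tensorMat T p f (extChartAt (𝓡 4) p p) +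
          tensorMat T p f (extChartAt (𝓡 4) p p) * fieldJac X p f)) a b := by
  set y := extChartAt (𝓡 4) p p with hy
  set w := fieldInChart p X y
  set L := fderiv ℝ (fieldInChart p X) y with hL
  obtain ⟨B, hB⟩ := hT y
  have h0 : lieD X T p u v = fderiv ℝ (fun z => tensorInChart p T z u v) y w
      + tensorInChart p T y (L u) v + tensorInChart p T y u (L v) := by
    have hu : chartDeriv p u = u := chartDeriv_apply p u
    have hv : chartDeriv p v = v := chartDeriv_apply p v
    unfold lieD
    rw [hu, hv]
  have h1 : fderiv ℝ (fun z => tensorInChart p T z u v) y w =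
      ∑ a, ∑ b, f.repr u a * f.repr v b * dirDeriv (tensorMat T p f) y w a b := by
    have e1 : (fun z => tensorInChart p T z u v) =
        fun z => ∑ a, ∑ b, f.repr u a * f.repr v b * tensorMat T p f z a b := by
      funext z
      exact (hT z).expand f u v
    have e2 := HasFDerivAt.fun_sum (u := Finset.univ) fun a _ =>
      HasFDerivAt.fun_sum (u := Finset.univ) fun b _ =>
        (hd a b).hasFDerivAt.const_mul (f.repr u a * f.repr v b)
    rw [e1, e2.fderiv]
    simp [_root_.sum_apply, dirDeriv]
  have hJ : ∀ a, L (f a) = ∑ c, fieldJac X p f c a • f c := fun a => (f.sum_repr _).symm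
  have h2 : tensorInChart p T y (L u) v = ∑ a, ∑ b, f.repr u a * f.repr v b *
      ((fieldJac X p f)ᵀ * tensorMat T p f y) a b := by
    have hb : IsBilin fun u v => tensorInChart p T y (L u) v :=
      ⟨B.comp (L : E4 →ₗ[ℝ] E4), fun u v => hB _ _⟩
    rw [hb.expand f u v]
    refine Finset.sum_congr rfl fun a _ => Finset.sum_congr rfl fun b _ => ?_
    congr 1
    rw [hB, hJ, map_sum, LinearMap.sum_apply, Matrix.mul_apply]
    refine Finset.sum_congr rfl fun c _ => ?_
    rw [map_smul, LinearMap.smul_apply, ← hB]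
    rfl
  have h3 : tensorInChart p T y u (L v) = ∑ a, ∑ b, f.repr u a * f.repr v b *
      (tensorMat T p f y * fieldJac X p f) a b := by
    have hb : IsBilin fun u v => tensorInChart p T y u (L v) :=
      ⟨B.compl₂ (L : E4 →ₗ[ℝ] E4), fun u v => hB _ _⟩
    rw [hb.expand f u v]
    refine Finset.sum_congr rfl fun a _ => Finset.sum_congr rfl fun b _ => ?_
    congr 1
    rw [hB, hJ, map_sum, Matrix.mul_apply]
    refine Finset.sum_congr rfl fun c _ => ?_
    rw [map_smul, ← hB, smul_eq_mul, mul_comm]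
    rfl
  rw [h0, h1, h2, h3]
  simp only [← Finset.sum_add_distrib, ← mul_add, Matrix.add_apply, add_assoc]

theorem sum_repr_basis (f : Module.Basis (Fin 4) ℝ E4) (F : Mat4) (a b : Fin 4) :
    ∑ c, ∑ d, f.repr (f a) c * f.repr (f b) d * F c d = F a b := by
  simp [Finsupp.single_apply]

theorem chartMat_base (S : Fin 3 → Form M 2) (p : M) (f : Fin 4 → E4) (i : Fin 3) (a b : Fin 4) :
    chartMat S p f (extChartAt (𝓡 4) p p) i a b = ev2 (S i p) (f a) (f b) :=
  formInChart_base (S i) p ![f a, f b]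

theorem lieD_triple {S : Fin 3 → Form M 2} (hS : IsSU2Structure S) {X : VField M}
    {t : Fin 3 → M → ℝ} (hX : IsSigmaKilling S X t) (p : M) (f : Module.Basis (Fin 4) ℝ E4)
    (i : Fin 3) :
    dirDeriv (fun z => chartMat S p f z i) (extChartAt (𝓡 4) p p)
        (fieldInChart p X (extChartAt (𝓡 4) p p)) +
      ((fieldJac X p f)ᵀ * chartMat S p f (extChartAt (𝓡 4) p p) i +
        chartMat S p f (extChartAt (𝓡 4) p p) i * fieldJac X p f) =
      t (i + 1) p • chartMat S p f (extChartAt (𝓡 4) p p) (i + 2) -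
        t (i + 2) p • chartMat S p f (extChartAt (𝓡 4) p p) (i + 1) := by
  ext a b
  have h := lieD_eq_sum X (fun q => ev2 (S i q)) p f
    (fun z => by
      have h1 : tensorInChart p (fun q => ev2 (S i q)) z = ev2 (formInChart p (S i) z) := by
        funext u v
        exact (ev2_formInChart (S i) p z u v).symm
      rw [h1]
      exact isBilin_ev2 _)
    (by rw [tensorMat_ev2]; exact differentiableAt_chartMat hS p f i) (f a) (f b)
  rw [sum_repr_basis, tensorMat_ev2] at h
  have h2 := hX i p (f a) (f b)
  simp only [mul_assoc] at h2
  rw [eps_sum i fun j k => t j p * ev2 (S k p) (f a) (f b)] at h2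
  rw [← h, Matrix.sub_apply, Matrix.smul_apply, Matrix.smul_apply, chartMat_base, chartMat_base]
  exact h2

/-- A vector field which rotates the triple is a Killing vector field. -/
theorem isKilling_of_isSigmaKilling {S : Fin 3 → Form M 2} (hS : IsSU2Structure S) (g : Metric M)
    (hg : ∀ p, IsMetricOf (fun i => S i p) (g.inner p)) {X : VField M}
    {t : Fin 3 → M → ℝ} (hX : IsSigmaKilling S X t) : IsKilling g X := by
  intro p u v
  let f : Module.Basis (Fin 4) ℝ E4 := (EuclideanSpace.basisFun (Fin 4) ℝ).toBasis
  obtain ⟨σ, hloc⟩ := exists_isLocalMetric_chart hS g hg p f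
  have h1 := hloc.dirDeriv_metric (fieldInChart p X (extChartAt (𝓡 4) p p)) (fieldJac X p f)
    (fun i => t i p) fun i => by
      rw [← lieD_triple hS hX p f i]
      abel
  have h2 := lieD_eq_sum X (fun q u v => g.inner q u v) p f
    (fun z => isBilin_comp (g.inner _) (chartSymmDeriv p z)) hloc.differentiableAt_metric u v
  rw [h2]
  refine Finset.sum_eq_zero fun a _ => Finset.sum_eq_zero fun b _ => ?_
  have h3 : tensorMat (fun q u v => g.inner q u v) p f = chartGram g p f := rfl
  rw [h3, h1, neg_add_cancel, Matrix.zero_apply, mul_zero]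

end Killing

/-! ### The exterior covariant derivative and the self-dual part -/

section Covariant

variable {M : Type*} [TopologicalSpace M] [ChartedSpace E4 M] [IsManifold (𝓡 4) ∞ M]
  {S : Fin 3 → Form M 2} {X : VField M}

/-- The triple of 1-forms `ι_X Σ^i`. -/
def interiorTriple (S : Fin 3 → Form M 2) (X : VField M) (i : Fin 3) : CovectorField M :=
  fun q => interior2 (X q) (S i q)

theorem hasFDerivAt_interiorTriple (hS : IsSU2Structure S) (hX : IsSmoothField X) (p : M)
    (f : Module.Basis (Fin 4) ℝ E4) (i : Fin 3) (b : Fin 4) :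
    HasFDerivAt (covectorInChart (interiorTriple S X i) p (f b))
      (∑ c, (fieldComp X p f (extChartAt (𝓡 4) p p) c •
          fderiv ℝ (fun z => chartMat S p f z i c b) (extChartAt (𝓡 4) p p) +
        chartMat S p f (extChartAt (𝓡 4) p p) i c b •
          fderiv ℝ (fun z => fieldComp X p f z c) (extChartAt (𝓡 4) p p)))
      (extChartAt (𝓡 4) p p) := by
  have h := HasFDerivAt.fun_sum (u := Finset.univ) fun c _ =>
    ((hasFDerivAt_fieldComp hX p f c).differentiableAt.hasFDerivAt.fun_mul
      (differentiableAt_chartMat hS p f i c b).hasFDerivAt)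
  refine h.congr_of_eventuallyEq ?_
  filter_upwards [extChartAt_target_mem_nhds_base p] with z hz
  exact covectorInChart_interior2 S X p f i b hz

theorem fderiv_interiorTriple (hS : IsSU2Structure S) (hX : IsSmoothField X) (p : M)
    (f : Module.Basis (Fin 4) ℝ E4) (i : Fin 3) (a b : Fin 4) :
    fderiv ℝ (covectorInChart (interiorTriple S X i) p (f b)) (extChartAt (𝓡 4) p p) (f a) =
      ∑ c, (fieldJac X p f c a * chartMat S p f (extChartAt (𝓡 4) p p) i c b +
        fieldComp X p f (extChartAt (𝓡 4) p p) c *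
          dirDeriv (fun z => chartMat S p f z i) (extChartAt (𝓡 4) p p) (f a) c b) := by
  rw [(hasFDerivAt_interiorTriple hS hX p f i b).fderiv, _root_.sum_apply]
  refine Finset.sum_congr rfl fun c _ => ?_
  rw [_root_.add_apply, _root_.smul_apply, _root_.smul_apply, fderiv_fieldComp hX, smul_eq_mul,
    smul_eq_mul, add_comm, mul_comm (chartMat _ _ _ _ _ _ _)]
  rfl

theorem compatible_components (hS : IsSU2Structure S) {A : Fin 3 → CovectorField M}
    (hA : IsCompatible S A) (p : M) (f : Fin 4 → E4) (i : Fin 3) (a b c : Fin 4) :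
    dirDeriv (fun z => chartMat S p f z i) (extChartAt (𝓡 4) p p) (f a) b c -
      dirDeriv (fun z => chartMat S p f z i) (extChartAt (𝓡 4) p p) (f b) a c +
      dirDeriv (fun z => chartMat S p f z i) (extChartAt (𝓡 4) p p) (f c) a b +
      ((A (i + 1) p (f a) * chartMat S p f (extChartAt (𝓡 4) p p) (i + 2) b c -
        A (i + 1) p (f b) * chartMat S p f (extChartAt (𝓡 4) p p) (i + 2) a c +
        A (i + 1) p (f c) * chartMat S p f (extChartAt (𝓡 4) p p) (i + 2) a b) -
       (A (i + 2) p (f a) * chartMat S p f (extChartAt (𝓡 4) p p) (i + 1) b c -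
        A (i + 2) p (f b) * chartMat S p f (extChartAt (𝓡 4) p p) (i + 1) a c +
        A (i + 2) p (f c) * chartMat S p f (extChartAt (𝓡 4) p p) (i + 1) a b)) = 0 := by
  have h := hA i p (f a) (f b) (f c)
  rw [eps_sum i fun j k => wedge12 (A j p) (ev2 (S k p)) (f a) (f b) (f c)] at h
  refine Eq.trans ?_ h
  simp only [chartMat_base]
  exact congrArg₂ (· + ·) (extD_two (hS.smooth i) p (f a) (f b) (f c)).symm rfl

theorem interiorTriple_components (p : M) (f : Module.Basis (Fin 4) ℝ E4) (i : Fin 3)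
    (b : Fin 4) :
    covectorInChart (interiorTriple S X i) p (f b) (extChartAt (𝓡 4) p p) =
      interior2 (X p) (S i p) (f b) :=
  -- The covector is viewed as a 2-tensor ignoring its first slot, so the first `f b` is a dummy.
  tensorInChart_base (fun q _ v => interior2 (X q) (S i q) v) p (f b) (f b)

theorem cartan_components (hS : IsSU2Structure S) (hX : IsSmoothField X) {t : Fin 3 → M → ℝ}
    (hXS : IsSigmaKilling S X t) {A : Fin 3 → CovectorField M} (hA : IsCompatible S A)
    {θ : Fin 3 → M → ℝ} (hθ : ∀ i p, θ i p = t i p + A i p (X p)) (p : M)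
    (f : Module.Basis (Fin 4) ℝ E4) (i : Fin 3) :
    let y := extChartAt (𝓡 4) p p
    let D : Fin 3 → Mat4 := fun i => of fun a b =>
      fderiv ℝ (covectorInChart (interiorTriple S X i) p (f b)) y (f a)
    let β : Fin 3 → Fin 4 → ℝ := fun i b => covectorInChart (interiorTriple S X i) p (f b) y
    D i - (D i)ᵀ + (wedgeMat (fun a => A (i + 1) p (f a)) (β (i + 2)) -
      wedgeMat (fun a => A (i + 2) p (f a)) (β (i + 1))) =
        θ (i + 1) p • chartMat S p f y (i + 2) - θ (i + 2) p • chartMat S p f y (i + 1) := by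
  intro y D β
  have hXp : ∀ i, A i p (X p) = ∑ c, A i p (f c) * fieldComp X p f y c := fun i => by
    have h1 : X p = ∑ c, fieldComp X p f y c • f c := by
      rw [← sum_fieldComp X p f y]
      exact (fieldInChart_base X p).symm
    have h2 : A i p (X p) = ∑ c, fieldComp X p f y c * A i p (f c) := by
      conv_lhs => rw [h1]
      exact (map_sum (A i p : E4 →L[ℝ] ℝ) _ _).trans
        (Finset.sum_congr rfl fun c _ => map_smul (A i p : E4 →L[ℝ] ℝ) _ _)
    rw [h2]
    exact Finset.sum_congr rfl fun c _ => mul_comm _ _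
  refine cartan_triple (s := chartMat S p f y) (fun i => formMat_transpose _ _)
    (fun c i => dirDeriv (fun z => chartMat S p f z i) y (f c)) (fun i a => A i p (f a))
    (fieldComp X p f y) (fieldJac X p f) β D (fun i => t i p) (fun i => θ i p)
    (fun i b => covectorInChart_interior2 S X p f i b (mem_extChartAt_target p))
    (fun i a b => fderiv_interiorTriple hS hX p f i a b) (fun i => ?_)
    (fun i a b c => compatible_components hS hA p f i a b c)
    (fun i => by rw [hθ, hXp]) i
  rw [← lieD_triple hS hXS p f i]
  congr 1
  ext a b
  simp only [Matrix.sum_apply, Matrix.smul_apply, dirDeriv, of_apply]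
  -- The derivative along X is expanded into partial derivatives along the basis.
  rw [sum_fieldComp X p f (extChartAt (𝓡 4) p p), map_sum]
  exact Finset.sum_congr rfl fun c _ => (map_smul _ _ _).symm

/-- `d^A ι_X Σ^i = ε^{ijk} θ^j Σ^k`. -/
theorem covD_interiorTriple (hS : IsSU2Structure S) (hX : IsSmoothField X) {t : Fin 3 → M → ℝ}
    (hXS : IsSigmaKilling S X t) {A : Fin 3 → CovectorField M} (hA : IsCompatible S A)
    {θ : Fin 3 → M → ℝ} (hθ : ∀ i p, θ i p = t i p + A i p (X p)) (i : Fin 3) (p : M)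
    (u v : TangentSpace (𝓡 4) p) :
    covD A (interiorTriple S X) i p u v = ∑ j, ∑ k, eps i j k * θ j p * ev2 (S k p) u v := by
  let f : Module.Basis (Fin 4) ℝ (TangentSpace (𝓡 4) p) :=
    (EuclideanSpace.basisFun (Fin 4) ℝ).toBasis
  refine IsBilin.ext_basis (f := covD A (interiorTriple S X) i p)
    (f' := fun u v => ∑ j, ∑ k, eps i j k * θ j p * ev2 (S k p) u v) ?_ ?_ f (fun a b => ?_) u v
  · exact (isBilin_ev2 _).add (IsBilin.sum fun j => IsBilin.sum fun k =>
      (isBilin_wedge11 (A j p : TangentSpace (𝓡 4) p →ₗ[ℝ] ℝ)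
        (interiorTriple S X k p : TangentSpace (𝓡 4) p →ₗ[ℝ] ℝ)).const_mul _)
  · exact IsBilin.sum fun j => IsBilin.sum fun k => (isBilin_ev2 (S k p)).const_mul _
  have hc : ∀ k b, covectorInChart (interiorTriple S X k) p (f b) (extChartAt (𝓡 4) p p) =
      interiorTriple S X k p (f b) := fun k b => interiorTriple_components p f k b
  have hw : ∀ j k, wedge11 (A j p) (interiorTriple S X k p) (f a) (f b) =
      A j p (f a) * covectorInChart (interiorTriple S X k) p (f b) (extChartAt (𝓡 4) p p) -
        A j p (f b) * covectorInChart (interiorTriple S X k) p (f a) (extChartAt (𝓡 4) p p) :=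
    fun j k => congrArg₂ (· - ·) (congrArg (A j p (f a) * ·) (hc k b).symm)
      (congrArg (A j p (f b) * ·) (hc k a).symm)
  have h := congrFun (congrFun (cartan_components hS hX hXS hA hθ p f i) a) b
  simp only [mul_assoc]
  rw [eps_sum i fun j k => θ j p * ev2 (S k p) (f a) (f b), covD,
    eps_sum i fun j k => wedge11 (A j p) (interiorTriple S X k p) (f a) (f b),
    extD_toForm f fun b => (hasFDerivAt_interiorTriple hS hX p f i b).differentiableAt]
  simp only [Matrix.add_apply, Matrix.sub_apply, Matrix.smul_apply, transpose_apply, smul_eq_mul,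
    of_apply, wedgeMat, chartMat_base] at h
  rw [hw, hw]
  exact h

theorem differentiableAt_flat (hX : IsSmoothField X) (g : Metric M) {p : M}
    (f : Module.Basis (Fin 4) ℝ E4) {σ : ℝ}
    (hloc : IsLocalMetric (chartMat S p f) (chartGram g p f) (extChartAt (𝓡 4) p p) σ)
    (b : Fin 4) :
    DifferentiableAt ℝ (covectorInChart (flat g X) p (f b)) (extChartAt (𝓡 4) p p) := by
  have h : DifferentiableAt ℝ (fun z => ∑ c, chartGram g p f z b c * fieldComp X p f z c)
      (extChartAt (𝓡 4) p p) :=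
    DifferentiableAt.fun_sum fun c _ => (hloc.differentiableAt_metric b c).fun_mul
      (hasFDerivAt_fieldComp hX p f c).differentiableAt
  refine h.congr_of_eventuallyEq ?_
  filter_upwards [extChartAt_target_mem_nhds_base p] with z hz
  exact covectorInChart_flat g X p f b hz

theorem interiorTriple_eq_mulVec (p : M) (f : Module.Basis (Fin 4) ℝ E4) (i : Fin 3) {z : E4}
    (hz : z ∈ (extChartAt (𝓡 4) p).target) :
    (fun b => covectorInChart (interiorTriple S X i) p (f b) z) =
      -(chartMat S p f z i *ᵥ fieldComp X p f z) := by
  funext b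
  refine (covectorInChart_interior2 S X p f i b hz).trans ?_
  rw [Pi.neg_apply, mulVec, dotProduct, ← Finset.sum_neg_distrib]
  refine Finset.sum_congr rfl fun c _ => ?_
  have h : chartMat S p f z i c b = -chartMat S p f z i b c :=
      congrFun (congrFun (formMat_transpose (formInChart p (S i) z) f) b) c
  rw [h]
  ring

/-- The wedge products of `dX^♭` with the triple. -/
theorem pairing_extD_flat (hS : IsSU2Structure S) (g : Metric M)
    (hX : IsSmoothField X) {t : Fin 3 → M → ℝ}
    (hXS : IsSigmaKilling S X t) {A : Fin 3 → CovectorField M} (hA : IsCompatible S A)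
    {θ : Fin 3 → M → ℝ} (hθ : ∀ i p, θ i p = t i p + A i p (X p)) {p : M}
    (f : Module.Basis (Fin 4) ℝ E4) {m σ : ℝ}
    (hloc : IsLocalMetric (chartMat S p f) (chartGram g p f) (extChartAt (𝓡 4) p p) σ)
    (ht : IsTriple (chartMat S p f (extChartAt (𝓡 4) p p)) m) (i : Fin 3) :
    pairing (chartMat S p f (extChartAt (𝓡 4) p p) i)
      (formMat (extD (flat g X).toForm p : E4 [⋀^Fin 2]→L[ℝ] ℝ) f) = 2 * σ * m * θ i p := by
  set y := extChartAt (𝓡 4) p p with hy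
  have hβ := fun i b => (hasFDerivAt_interiorTriple hS hX p f i b).differentiableAt
  have hα := differentiableAt_flat hX g f hloc
  let Dα : Mat4 := of fun a b => fderiv ℝ (covectorInChart (flat g X) p (f b)) y (f a)
  have hmat : formMat (extD (flat g X).toForm p : E4 [⋀^Fin 2]→L[ℝ] ℝ) f = Dα - Dαᵀ := by
    ext a b
    exact extD_toForm f hα (f a) (f b)
  have hid : ∀ i, ∀ᶠ z in 𝓝 y,
      dualMat (chartMat S p f z i) *ᵥ (fun b => covectorInChart (flat g X) p (f b) z) =
      σ • (dualMat (chartMat S p f z (i + 1)) *ᵥ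
        fun b => covectorInChart (interiorTriple S X (i + 2)) p (f b) z) := fun i => by
    filter_upwards [hloc.dualMat_mulVec (fieldComp X p f) i,
      extChartAt_target_mem_nhds_base p] with z hz1 hz
    rw [interiorTriple_eq_mulVec p f _ hz, ← hz1]
    congr 1
    funext b
    exact covectorInChart_flat g X p f b hz
  rw [hmat]
  exact ht.pairing_of_divergence
    (fun c i => dirDeriv (fun z => chartMat S p f z i) y (f c)) (fun i a => A i p (f a))
    (fieldComp X p f y) (fun b => covectorInChart (flat g X) p (f b) y) Dα
    (fun i b => covectorInChart (interiorTriple S X i) p (f b) y)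
    (fun i => of fun a b => fderiv ℝ (covectorInChart (interiorTriple S X i) p (f b)) y (f a))
    (fun i => θ i p) (fun i => interiorTriple_eq_mulVec p f i (mem_extChartAt_target p))
    (fun i a b c => compatible_components hS hA p f i a b c)
    (fun i => (hid i).self_of_nhds)
    (fun i => hloc.divergence f (fun z b => covectorInChart (flat g X) p (f b) z)
      (fun z i b => covectorInChart (interiorTriple S X i) p (f b) z) hα hβ i (hid i))
    (fun i => cartan_components hS hX hXS hA hθ p f i) i

theorem exists_basis_of_orthonormalFrame {g : E4 →L[ℝ] E4 →L[ℝ] ℝ} {b : Fin 4 → E4}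
    (hb : IsOrthonormalFrame g b) : ∃ f : Module.Basis (Fin 4) ℝ E4, ⇑f = b := by
  have hli : LinearIndependent ℝ b := by
    refine Fintype.linearIndependent_iff.2 fun c hc j => ?_
    have h := congrArg (fun v => g v (b j)) hc
    simpa [_root_.sum_apply, hb _ j] using h
  exact ⟨basisOfLinearIndependentOfCardEqFinrank hli (by simp),
    coe_basisOfLinearIndependentOfCardEqFinrank hli _⟩

end Covariant

end SigmaKilling

end

theorem mainTheorem3
    {M : Type*} [TopologicalSpace M] [ChartedSpace E4 M] [IsManifold (𝓡 4) ∞ M]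
    (S : Fin 3 → Form M 2) (hS : IsSU2Structure S)
    (g : Metric M) (hg : ∀ p, IsMetricOf (fun i => S i p) (g.inner p))
    (X : VField M) (hX : IsSmoothField X)
    (θt : Fin 3 → M → ℝ) (hXS : IsSigmaKilling S X θt) :
    IsKilling g X ∧
    ∀ A : Fin 3 → CovectorField M, IsCompatible S A →
      ∀ θ : Fin 3 → M → ℝ, (∀ i p, θ i p = θt i p + A i p (X p)) →
        (∀ i p u v,
          covD A (fun i p => interior2 (X p) (S i p)) i p u v =
            ∑ j, ∑ k, eps i j k * θ j p * ev2 (S k p) u v) ∧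
        (∀ p, IsQuaternionic (fun i => S i p) (g.inner p) →
          ∀ b, IsOrthonormalFrame (g.inner p) b →
          (∀ i, θ i p =
            -(1 / 4) * contract2 b (S i p) (extD (flat g X).toForm p)) ∧
          (∀ vol, IsVolumeForm (g.inner p) vol →
            (∀ i u v, hodge2 vol b (S i p) u v = ev2 (S i p) u v) →
            ∀ u v,
              (1 / 2) * (ev2 (extD (flat g X).toForm p) u v
                  + hodge2 vol b (extD (flat g X).toForm p) u v) =
                -∑ i, θ i p * ev2 (S i p) u v)) := by
  refine ⟨isKilling_of_isSigmaKilling hS g hg hXS, fun A hA θ hθ =>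
    ⟨covD_interiorTriple hS hX hXS hA hθ, fun p hq b hb => ?_⟩⟩
  -- The orthonormal frame at `p` itself serves as the constant coordinate basis, which is
  -- legitimate because the chart has identity derivative at `p`.
  obtain ⟨f, rfl⟩ := exists_basis_of_orthonormalFrame (g := g.inner p) (b := b) hb
  obtain ⟨σ, hloc⟩ := exists_isLocalMetric_chart hS g hg p f
  obtain ⟨m, hm, ht, hmG⟩ := hloc.eventually.self_of_nhds
  have hF := pairing_extD_flat hS g hX hXS hA hθ f hloc ht
  have hs : chartMat S p f (extChartAt (𝓡 4) p p) =
      fun i => formMat (S i p : E4 [⋀^Fin 2]→L[ℝ] ℝ) f := by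
    funext i
    ext x y
    exact chartMat_base S p f i x y
  have hG : chartGram g p f (extChartAt (𝓡 4) p p) =
      gramMat (g.inner p : E4 →L[ℝ] E4 →L[ℝ] ℝ) f := by
    ext x y
    exact tensorInChart_base (fun q u v => g.inner q u v) p (f x) (f y)
  rw [hs] at ht hmG hF
  rw [hG] at hmG
  exact selfDual_part hq f hb hm ht hmG hF
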